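/- Theorem (quantified local convergence of the shifted $J$-method for the Gross--Pitaevskii problem). Let $d\in\{2,3\}$, let $\mathcal D\subset\mathbb R^d$ be bounded and open, $W\in L^\infty(\mathcal D,\mathbb R)$, $\Omega\in\mathbb R$, $\kappa\ge 0$. Let $V=H^1_0(\mathcal D,\mathbb C)$ with norm $\|v\|_V=\|\nabla v\|_{L^2}$ and $H=L^2(\mathcal D,\mathbb C)$ with norm $\|\cdot\|$, both regarded as real Hilbert spaces, with $(v,w)_H=\mathrm{Re}\int_{\mathcal D}v\overline w\,dx$; let $\langle \mathcal I v,w\rangle=(v,w)_H$. Put $R(x,y)=(y,-x)$ if $d=2$ and $R(x,y,z)=(y,-x,0)$ if $d=3$, $\nabla_R v=\nabla v+\mathrm i\frac{\Omega}{2}R\,v$, $W_R=W-\frac{\Omega^2}{4}|R|^2$, and $$\langle A(u,v),w\rangle=\mathrm{Re}\Big(\int_{\mathcal D}\nabla_R v\cdot\overline{\nabla_R w}+W_R\,v\overline w\,dx+\frac{\kappa}{\|u\|^2}\int_{\mathcal D}|u|^2v\overline w\,dx\Big),$$ $$\langle J(u)v,w\rangle=\mathrm{Re}\Big(\int_{\mathcal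 D}\nabla_R v\cdot\overline{\nabla_R w}+W_R\,v\overline w\,dx+\frac{\kappa}{\|u\|^2}\int_{\mathcal D}(u\overline v+2v\overline u)u\overline w\,dx-\frac{2\kappa (u,v)_H}{\|u\|^4}\int_{\mathcal D}|u|^2u\overline w\,dx\Big),$$ so that $J(u)$ is the real Fréchet derivative of $u\mapsto A(u,u)$, and let $J_\sigma(u)=J(u)+\sigma\mathcal I\colon V\to V^*$. Let $u^*\in V$, $\|u^*\|=1$, $\lambda^*\in\mathbb R$ satisfy $A(u^*,u^*)=\lambda^*\mathcal I u^*$, i.e. $u^*$ is a normalized weak eigenfunction of $-\Delta u+Wu-\Omega\mathcal L_z u+\kappa|u|^2u=\lambda u$, where $\mathcal L_z=-\mathrm i(x\partial_y-y\partial_x)$. Assume that the eigenvalue $\lambda^*$ of $J(u^*)$ is simple up to the phase symmetry $u\mapsto e^{\mathrm i\theta}u$: every generalized eigenfunction (element of a Jordan chain) of $J(u^*)$ for $\lambda^*$ is a complex multiple of $u^*$. Let $\sigma\in\mathbb R$, $\sigma\ne-\lambda^*$, be such that $J_\sigma(u^*)$ has a bounded inverse, let $\mu\ne\lambda^*$ be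 a real eigenvalue of $J(u^*)$ for which $|\mu+\sigma|$ is minimal among all real eigenvalues of $J(u^*)$ different from $\lambda^*$, and assume $$\rho:=\frac{|\lambda^*+\sigma|}{|\mu+\sigma|}<1 .$$ For $u^0\in V$ let $u^{n+1}=\phi(u^n)=\dfrac{J_\sigma(u^n)^{-1}\mathcal I u^n}{\|J_\sigma(u^n)^{-1}\mathcal I u^n\|}$ and let $s=\mathrm{sign}(\lambda^*+\sigma)\in\{1,-1\}$. Then: (i) There is a neighborhood $S\subset V$ of $u^*$ such that for all $u^0\in S$ every $J_\sigma(u^n)$, $n\ge 0$, has a bounded inverse (so that all iterates are defined), and there is $c\in\mathbb C$ with $|c|=1$ and $$\lim_{n\to\infty}\|s^nu^n-c\,u^*\|_V=0 .$$ (ii) For every $\varepsilon>0$ there are a neighborhood $S_\varepsilon\subset V$ of $u^*$ and a constant $C(\varepsilon)>0$ such that for all $u^0\in S_\varepsilon$ every $J_\sigma(u^n)$, $n\ge0$, has a bounded inverse and there is $c\in\mathbb C$ with $|c|=1$ and, for all $n\ge0$, $$\|s^nu^n-c\,u^*\|_V\le C(\varepsilon)\,(\rho+\varepsilon)^n\,\|u^0-u^*\|_V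 .$$ (For $n=0$ this shows that $c$ is close to $1$ when $u^0$ is close to $u^*$; for $\sigma>-\lambda^*$ one has $s=1$.) -/

import Mathlib

open MeasureTheory Filter Topology
open scoped ContDiff ComplexConjugate

noncomputable section

namespace GPE

/-- Points of `ℝ^d`, with the Euclidean norm. -/
abbrev Pt (d : ℕ) : Type := EuclideanSpace ℝ (Fin d)

/-- `L²(D, ℂ)`. -/
abbrev L2 {d : ℕ} (D : Set (Pt d)) : Type := Lp ℂ 2 (volume.restrict D)

/-- `L²(D, ℂ^d)`. -/
abbrev L2Vec {d : ℕ} (D : Set (Pt d)) : Type :=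
  Lp (EuclideanSpace ℂ (Fin d)) 2 (volume.restrict D)

/-- The classical gradient of a complex-valued function on `ℝ^d`. -/
def classicalGrad {d : ℕ} (f : Pt d → ℂ) (x : Pt d) : EuclideanSpace ℂ (Fin d) :=
  WithLp.toLp 2 (fun k => fderiv ℝ f x (EuclideanSpace.single k (1 : ℝ)))

/-- The pairs `(f, ∇f)` in `L² × L²` given by smooth functions `f` with compact support in `D`. -/
def testPairs {d : ℕ} (D : Set (Pt d)) : Set (WithLp 2 (L2 D × L2Vec D)) :=
  {p | ∃ f : Pt d → ℂ, ContDiff ℝ ∞ f ∧ HasCompactSupport f ∧ tsupport f ⊆ D ∧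
    (p.fst : Pt d → ℂ) =ᵐ[volume.restrict D] f ∧
    (p.snd : Pt d → EuclideanSpace ℂ (Fin d)) =ᵐ[volume.restrict D] classicalGrad f}

/-- `H¹₀(D, ℂ)`: the closure of the smooth functions with compact support in `D` with respect
to the `H¹` norm. An element is recorded together with its weak gradient, that is as the pair
`(v, ∇v)` in `L² × L²`. (The test pairs already form a subspace; the span adds nothing.) -/
def H10 {d : ℕ} (D : Set (Pt d)) : Submodule ℂ (WithLp 2 (L2 D × L2Vec D)) :=
  (Submodule.span ℂ (testPairs D)).topologicalClosure

variable {d : ℕ} {D : Set (Pt d)}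

/-- The underlying `L²` function of an element of `H¹₀`. -/
def fn (v : H10 D) : L2 D := (v : WithLp 2 (L2 D × L2Vec D)).fst

/-- The weak gradient of an element of `H¹₀`. -/
def grad (v : H10 D) : L2Vec D := (v : WithLp 2 (L2 D × L2Vec D)).snd

/-- The norm of `H = L²(D)`. -/
def hNorm (v : H10 D) : ℝ := ‖fn v‖

/-- The norm `‖∇v‖` of `V = H¹₀(D)`. -/
def vNorm (v : H10 D) : ℝ := ‖grad v‖

/-- The real inner product `Re ∫ v conj(w)` of `H`. -/
def hInner (v w : H10 D) : ℝ := (∫ x in D, fn v x * conj (fn w x)).re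

/-- The `k`-th coordinate of a point (`0` if there is none). -/
def coord (x : Pt d) (k : ℕ) : ℝ := if h : k < d then x ⟨k, h⟩ else 0

/-- The vector field `R(x,y) = (y,-x)`, respectively `R(x,y,z) = (y,-x,0)`. -/
def rotField (x : Pt d) (k : Fin d) : ℝ :=
  if k.val = 0 then coord x 1 else if k.val = 1 then -coord x 0 else 0

/-- The rotational gradient `∇_R v = ∇v + i (Ω/2) R v`. -/
def rotGrad (Ω : ℝ) (v : H10 D) (x : Pt d) (k : Fin d) : ℂ :=
  grad v x k + Complex.I * ((Ω / 2 * rotField x k : ℝ) : ℂ) * fn v x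

/-- The potential `W_R = W - (Ω²/4) |R|²`, where `|R(x)|² = x² + y²`. -/
def rotPot (Ω : ℝ) (W : Pt d → ℝ) (x : Pt d) : ℝ :=
  W x - Ω ^ 2 / 4 * ∑ k, rotField x k ^ 2

/-- The linear part `∫ ∇_R v · conj(∇_R w) + W_R v conj(w)`, which is the weak form of
`-Δ + W - Ω L_z`. -/
def linForm (Ω : ℝ) (W : Pt d → ℝ) (v w : H10 D) : ℂ :=
  ∫ x in D, ((∑ k, rotGrad Ω v x k * conj (rotGrad Ω w x k)) +
    (rotPot Ω W x : ℂ) * fn v x * conj (fn w x))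

/-- `⟨A(u,v), w⟩`, where `A(u,·)` is the Gross-Pitaevskii operator with density `|u|²/‖u‖²`. -/
def gpA (Ω κ : ℝ) (W : Pt d → ℝ) (u v w : H10 D) : ℝ :=
  (linForm Ω W v w + ((κ / hNorm u ^ 2 : ℝ) : ℂ) *
    ∫ x in D, ((‖fn u x‖ ^ 2 : ℝ) : ℂ) * fn v x * conj (fn w x)).re

/-- `(u, lam)` is an eigenpair of the Gross-Pitaevskii problem with `‖u‖ = 1`. -/
def IsNormalizedEigenpair (Ω κ : ℝ) (W : Pt d → ℝ) (u : H10 D) (lam : ℝ) : Prop :=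
  hNorm u = 1 ∧ ∀ w : H10 D, gpA Ω κ W u u w = lam * hInner u w

/-- `⟨J(u) v, w⟩`, where `J(u)` is the real Fréchet derivative of `u ↦ A(u,u)`. -/
def gpJ (Ω κ : ℝ) (W : Pt d → ℝ) (u v w : H10 D) : ℝ :=
  (linForm Ω W v w
    + ((κ / hNorm u ^ 2 : ℝ) : ℂ) *
      (∫ x in D, (fn u x * conj (fn v x) + 2 * fn v x * conj (fn u x)) * fn u x * conj (fn w x))
    - ((2 * κ * hInner u v / hNorm u ^ 4 : ℝ) : ℂ) *
      (∫ x in D, ((‖fn u x‖ ^ 2 : ℝ) : ℂ) * fn u x * conj (fn w x))).re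

/-- `ν` is an eigenvalue of `J(u)`. -/
def IsEigenvalueJ (Ω κ : ℝ) (W : Pt d → ℝ) (u : H10 D) (ν : ℝ) : Prop :=
  ∃ v : H10 D, v ≠ 0 ∧ ∀ w : H10 D, gpJ Ω κ W u v w = ν * hInner v w

/-- `v` satisfies `(J(u) - ν)^k v = 0`: it is the top of a Jordan chain of length at most `k`. -/
def IsGenEigenfunctionJ (Ω κ : ℝ) (W : Pt d → ℝ) (u : H10 D) (ν : ℝ) : ℕ → H10 D → Prop
  | 0, v => v = 0
  | k + 1, v => ∃ z : H10 D, IsGenEigenfunctionJ Ω κ W u ν k z ∧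
      ∀ w : H10 D, gpJ Ω κ W u v w - ν * hInner v w = hInner z w

/-- The eigenvalue `lam` of `J(u)` is simple (in the algebraic sense) up to the phase of `u`:
all its generalized eigenfunctions are complex multiples of `u`. -/
def IsSimpleUpToPhase (Ω κ : ℝ) (W : Pt d → ℝ) (u : H10 D) (lam : ℝ) : Prop :=
  IsEigenvalueJ Ω κ W u lam ∧
    ∀ (k : ℕ) (v : H10 D), IsGenEigenfunctionJ Ω κ W u lam k v → ∃ c : ℂ, v = c • u

/-- `(J(u) + σ I) v = F` in the (real) dual space of `H¹₀`. -/
def SolvesShifted (Ω κ : ℝ) (W : Pt d → ℝ) (σ : ℝ) (u v : H10 D) (F : H10 D → ℝ) : Prop :=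
  ∀ w : H10 D, gpJ Ω κ W u v w + σ * hInner v w = F w

/-- `J_σ(u) = J(u) + σ I`, as a map from `H¹₀` to its real dual, has a bounded inverse. -/
def HasBoundedInverse (Ω κ : ℝ) (W : Pt d → ℝ) (σ : ℝ) (u : H10 D) : Prop :=
  (∀ F : H10 D →L[ℝ] ℝ, ∃! v : H10 D, SolvesShifted Ω κ W σ u v F) ∧
  ∃ C : ℝ, ∀ (F : H10 D →L[ℝ] ℝ) (v : H10 D), SolvesShifted Ω κ W σ u v F → vNorm v ≤ C * ‖F‖

open Classical in
/-- `ψ(u) = J_σ(u)⁻¹ I u`, with the value `0` where this is undefined. -/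
def psi (Ω κ : ℝ) (W : Pt d → ℝ) (σ : ℝ) (u : H10 D) : H10 D :=
  if h : ∃ v : H10 D, SolvesShifted Ω κ W σ u v (hInner u) then h.choose else 0

/-- One step `φ(u) = ψ(u) / ‖ψ(u)‖` of the shifted `J`-method. -/
def phi (Ω κ : ℝ) (W : Pt d → ℝ) (σ : ℝ) (u : H10 D) : H10 D :=
  (hNorm (psi Ω κ W σ u))⁻¹ • psi Ω κ W σ u

/-- The iterates `u^0, u^{n+1} = φ(u^n)` of the shifted `J`-method. -/
def iter (Ω κ : ℝ) (W : Pt d → ℝ) (σ : ℝ) (u₀ : H10 D) : ℕ → H10 D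
  | 0 => u₀
  | n + 1 => phi Ω κ W σ (iter Ω κ W σ u₀ n)

end GPE

end

set_option linter.unusedSectionVars false

/-! ### Operator theory: compact self-adjoint operators and adapted norms. -/

noncomputable section

namespace GPE

/-! Write u for the eigenfunction, λ for its eigenvalue, J_σ for J(u) + σI, and Q for the
H-orthogonal projection along the complex line ℂu. One step of the method is equivariant under
complex factors up to normalization, so it acts on complex lines. Near ℂu a line has an affine
coordinate y ⊥ ℂu (`chart`), and convergence up to phase means y → 0 together with convergence of
the phases.

The linearization at y = 0 rests on two facts. Homogeneity gives J(v)v = A(v,v), and differentiating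
this identity at u gives (J'(u)y)u = 0; hence ψ(u + y) = (λ+σ)⁻¹u + J_σ⁻¹y + o(y)
(`exists_J_add_self_le`, `eventually_norm_psi_sub_le`). Also J(u) acts as λ on the whole line ℂu
(`J_smul_self`). In the coordinate y the derivative of the step is therefore L = (λ+σ) Q J_σ⁻¹.

J(u) is not symmetric, but its rank one part vanishes on the range of Q, so T = Q J_σ⁻¹ Q is
self-adjoint on H, and it is compact by Rellich's theorem. A nonzero eigenvalue τ of T produces the
eigenvalue τ⁻¹ - σ of J(u), and algebraic simplicity up to phase excludes τ⁻¹ - σ = λ. Hence ‖T‖ ≤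
1/|μ+σ| (`norm_resolvH_le`), and the powers of L on V are O(ρ^k). For every θ > ρ an equivalent norm
makes the nonlinear step a contraction with factor θ (`exists_adapted_norm`, `exists_contraction`).
The phase, corrected by the sign of λ+σ, changes in each step by at most a multiple of the size of
y, which is summable; its limit is c (`exists_convergence_of_power_bound`).

This argument is carried out for abstract `FormData`. The concrete problem supplies that data
through the Sobolev embedding into L⁴, a proof of Rellich's theorem by averaging over balls, and the
fact that a function in H¹₀ determines its weak gradient. -/

/-- A compact self-adjoint operator is bounded by the moduli of its eigenvalues. -/
theorem norm_le_of_hasEigenvalue_le {H : Type*} [NormedAddCommGroup H] [InnerProductSpace ℝ H]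
    [CompleteSpace H] {T : H →L[ℝ] H} (hT : IsSelfAdjoint T) (hc : IsCompactOperator T)
    {r : ℝ} (hr : 0 ≤ r)
    (h : ∀ (τ : ℝ) (x : H), τ ≠ 0 → x ≠ 0 → T x = τ • x → |τ| ≤ r) : ‖T‖ ≤ r := by
  -- The nonzero spectrum of a compact operator consists of eigenvalues, and for a self-adjoint
  -- operator the spectral radius is the norm, over ℝ as well.
  have h1 : spectralRadius ℝ T ≤ ENNReal.ofReal r := by
    refine iSup₂_le fun k hk => ?_
    by_cases hk0 : k = 0
    · simp [hk0]
    obtain ⟨x, hx⟩ := ((hc.hasEigenvalue_iff_mem_spectrum hk0).2 hk).exists_hasEigenvector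
    have := h k x hk0 hx.2 hx.apply_eq_smul
    rw [← enorm_eq_nnnorm, ← ofReal_norm]
    exact ENNReal.ofReal_le_ofReal this
  rw [ContinuousLinearMap.spectralRadius_eq_nnnorm T hT, ← enorm_eq_nnnorm,
    ← ofReal_norm] at h1
  exact (ENNReal.ofReal_le_ofReal_iff hr).1 h1

/-- A bounded operator whose powers decay at rate `ρ` is a strict contraction with factor `θ > ρ`
in a suitable equivalent norm. -/
theorem exists_adapted_norm {E : Type*} [NormedAddCommGroup E] [NormedSpace ℝ E]
    (L : E →L[ℝ] E) {C ρ θ : ℝ} (hρ : 0 ≤ ρ) (hθ : ρ < θ)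
    (h : ∀ k y, ‖(L ^ k) y‖ ≤ C * ρ ^ k * ‖y‖) :
    ∃ (N : E → ℝ) (K : ℝ), 0 < K ∧ (∀ x y, N (x + y) ≤ N x + N y) ∧ (∀ y, ‖y‖ ≤ N y) ∧
      (∀ y, N y ≤ K * ‖y‖) ∧ ∀ y, N (L y) ≤ θ * N y := by
  have hθ0 : 0 < θ := hρ.trans_lt hθ
  obtain ⟨m, hm0, hm⟩ : ∃ m : ℕ, 0 < m ∧ C * ρ ^ m ≤ θ ^ m := by
    have h1 : Tendsto (fun m : ℕ => C * (ρ / θ) ^ m) atTop (𝓝 (C * 0)) :=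
      (tendsto_pow_atTop_nhds_zero_of_lt_one (by positivity) ((div_lt_one hθ0).2 hθ)).const_mul C
    rw [mul_zero] at h1
    obtain ⟨m, hm, hm0⟩ := ((h1.eventually (gt_mem_nhds one_pos)).and (eventually_gt_atTop 0)).exists
    refine ⟨m, hm0, ?_⟩
    rw [div_pow, ← mul_div_assoc, div_lt_one (by positivity)] at hm
    exact hm.le
  -- Applying L shifts this sum by one index and costs a factor θ. The new last term θ⁻ᵐ‖Lᵐy‖ is at
  -- most the lost first term ‖y‖ by the choice of m. The summand 1 in K keeps it positive even if E
  -- is trivial.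
  refine ⟨fun y => ∑ k ∈ Finset.range m, (θ⁻¹) ^ k * ‖(L ^ k) y‖,
    1 + ∑ k ∈ Finset.range m, (θ⁻¹) ^ k * ‖L ^ k‖, by positivity, fun x y => ?_, fun y => ?_,
    fun y => ?_, fun y => ?_⟩
  · rw [← Finset.sum_add_distrib]
    refine Finset.sum_le_sum fun k _ => ?_
    rw [← mul_add, map_add]
    gcongr
    exact norm_add_le _ _
  · have := Finset.single_le_sum (f := fun k => (θ⁻¹) ^ k * ‖(L ^ k) y‖)
      (fun k _ => by positivity) (Finset.mem_range.2 hm0)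
    simpa using this
  · rw [add_mul, one_mul, Finset.sum_mul]
    refine le_add_of_nonneg_of_le (norm_nonneg _) (Finset.sum_le_sum fun k _ => ?_)
    rw [mul_assoc]
    gcongr
    exact (L ^ k).le_opNorm y
  · have e : ∀ k, (θ⁻¹) ^ k * ‖(L ^ k) (L y)‖ = θ * ((θ⁻¹) ^ (k + 1) * ‖(L ^ (k + 1)) y‖) := by
      intro k
      rw [pow_succ L, mul_apply_eq_comp, pow_succ]
      field_simp
    simp only [e]
    rw [← Finset.mul_sum]
    refine mul_le_mul_of_nonneg_left ?_ hθ0.le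
    have h2 := Finset.sum_range_succ (fun k => (θ⁻¹) ^ k * ‖(L ^ k) y‖) m
    rw [Finset.sum_range_succ'] at h2
    have h3 : (θ⁻¹) ^ m * ‖(L ^ m) y‖ ≤ ‖y‖ := by
      rw [inv_pow, inv_mul_le_iff₀ (by positivity)]
      exact (h m y).trans (by gcongr)
    simp only [pow_zero, one_mul, one_apply_eq_self] at h2
    linarith

end GPE
end

/-! ### The abstract problem and its equivariance under complex scalars. -/

noncomputable section

namespace GPE

/-- The functional-analytic data of a Gross-Pitaevskii problem: the embedding `j` of the form
domain `E` into `H`, the linear part `a` and the multiplication `M v w = v w`. -/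
structure FormData (E H G : Type*) [NormedAddCommGroup E] [NormedSpace ℝ E] [Module ℂ E]
    [NormedAddCommGroup H] [InnerProductSpace ℝ H]
    [NormedAddCommGroup G] [InnerProductSpace ℝ G] where
  j : E →L[ℝ] H
  a : E →L[ℝ] E →L[ℝ] ℝ
  M : E →L[ℝ] E →L[ℝ] G
  κ : ℝ
  j_injective : Function.Injective j
  j_compact : IsCompactOperator j
  a_symm : ∀ v w, a v w = a w v
  M_symm : ∀ v w, M v w = M w v
  -- H and G need no complex structure: phase invariance enters only through the rule that c and its
  -- conjugate are adjoint for the three real forms. No coercivity of `a` is required either, since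
  -- invertibility at u is assumed where it is needed.
  j_smul : ∀ (c : ℂ) v w, inner ℝ (j (c • v)) (j w) = inner ℝ (j v) (j (conj c • w))
  a_smul : ∀ (c : ℂ) v w, a (c • v) w = a v (conj c • w)
  M_smul : ∀ (c : ℂ) v w x y, inner ℝ (M (c • v) w) (M x y) = inner ℝ (M v w) (M (conj c • x) y)

namespace FormData

variable {E H G : Type*} [NormedAddCommGroup E] [NormedSpace ℝ E] [NormedSpace ℂ E]
  [IsScalarTower ℝ ℂ E] [NormedAddCommGroup H] [InnerProductSpace ℝ H]
  [NormedAddCommGroup G] [InnerProductSpace ℝ G] (P : FormData E H G)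

/-- The real inner product as a continuous bilinear map. -/
def ip (H : Type*) [NormedAddCommGroup H] [InnerProductSpace ℝ H] : H →L[ℝ] H →L[ℝ] ℝ :=
  (isBoundedBilinearMap_inner (𝕜 := ℝ) (E := H)).toContinuousLinearMap

@[simp] theorem ip_apply (x y : H) : ip H x y = inner ℝ x y := rfl

/-- The functional `w ↦ (h, w)`. -/
def riesz : H →L[ℝ] E →L[ℝ] ℝ := ((ContinuousLinearMap.compL ℝ E H ℝ).flip P.j).comp (ip H)

@[simp] theorem riesz_apply (h : H) (w : E) : P.riesz h w = inner ℝ h (P.j w) := rfl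

/-- The cubic part of `J(u)` without its scalar factors. -/
def J1 (u : E) : E →L[ℝ] E →L[ℝ] ℝ :=
  ((ContinuousLinearMap.compL ℝ E G ℝ) (ip G (P.M u u))).comp P.M +
    (2 : ℝ) • (((ContinuousLinearMap.compL ℝ E G ℝ).flip (P.M u)).comp ((ip G).comp (P.M u)))

/-- The rank one part of `J(u)` without its scalar factors. -/
def J2 (u : E) : E →L[ℝ] E →L[ℝ] ℝ :=
  (P.riesz (P.j u)).smulRight ((ip G (P.M u u)).comp (P.M u))

/-- The operator `J(u)`. -/
def J (u : E) : E →L[ℝ] E →L[ℝ] ℝ :=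
  P.a + (P.κ / ‖P.j u‖ ^ 2) • P.J1 u - (2 * P.κ / ‖P.j u‖ ^ 4) • P.J2 u

theorem J_apply (u v w : E) : P.J u v w = P.a v w
    + P.κ / ‖P.j u‖ ^ 2 * (inner ℝ (P.M u u) (P.M v w) + 2 * inner ℝ (P.M u v) (P.M u w))
    - 2 * P.κ / ‖P.j u‖ ^ 4 * (inner ℝ (P.j u) (P.j v) * inner ℝ (P.M u u) (P.M u w)) := by
  simp [J, J1, J2]
  ring

/-- The shifted operator `J(u) + σ I`. -/
def Js (σ : ℝ) (u : E) : E →L[ℝ] E →L[ℝ] ℝ := P.J u + σ • (P.riesz.comp P.j)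

theorem Js_apply (σ : ℝ) (u v w : E) :
    P.Js σ u v w = P.J u v w + σ * inner ℝ (P.j v) (P.j w) := by
  simp [Js]

theorem continuousAt_Js (σ : ℝ) {u : E} (hu : P.j u ≠ 0) : ContinuousAt (P.Js σ) u := by
  have h : ‖P.j u‖ ≠ 0 := norm_ne_zero_iff.2 hu
  have h1 : Continuous P.J1 := by unfold J1; fun_prop
  have h2 : Continuous P.J2 := by
    have : P.J2 = fun u => ContinuousLinearMap.smulRightL ℝ E (E →L[ℝ] ℝ) (P.riesz (P.j u))
        ((ip G (P.M u u)).comp (P.M u)) := rfl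
    rw [this]; fun_prop
  unfold Js J
  have e1 : ContinuousAt (fun u => P.κ / ‖P.j u‖ ^ 2) u := by
    refine ContinuousAt.div (by fun_prop) (by fun_prop) (by positivity)
  have e2 : ContinuousAt (fun u => 2 * P.κ / ‖P.j u‖ ^ 4) u := by
    refine ContinuousAt.div (by fun_prop) (by fun_prop) (by positivity)
  have : ContinuousAdd (E →L[ℝ] E →L[ℝ] ℝ) :=
    ContinuousLinearMap.topologicalAddGroup.toContinuousAdd
  have : ContinuousSub (E →L[ℝ] E →L[ℝ] ℝ) :=
    @IsTopologicalAddGroup.to_continuousSub _ _ _ ContinuousLinearMap.topologicalAddGroup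
  have e3 := e1.smul h1.continuousAt
  have e4 := e2.smul h2.continuousAt
  exact ((continuousAt_const.add e3).sub e4).add continuousAt_const

theorem conj_smul_smul (c : ℂ) (v : E) : conj c • c • v = (‖c‖ ^ 2) • v := by
  rw [smul_smul, mul_comm, Complex.mul_conj, Complex.normSq_eq_norm_sq]
  rw [← algebraMap_smul ℂ (‖c‖ ^ 2) v]; rfl

theorem inner_j_smul_smul (c : ℂ) (v w : E) :
    inner ℝ (P.j (c • v)) (P.j (c • w)) = ‖c‖ ^ 2 * inner ℝ (P.j v) (P.j w) := by
  rw [P.j_smul, conj_smul_smul, map_smul, inner_smul_right]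

theorem norm_j_smul (c : ℂ) (v : E) : ‖P.j (c • v)‖ = ‖c‖ * ‖P.j v‖ := by
  have := P.inner_j_smul_smul c v v
  rw [real_inner_self_eq_norm_sq, real_inner_self_eq_norm_sq, ← mul_pow] at this
  exact (pow_left_inj₀ (by positivity) (by positivity) two_ne_zero).1 this

theorem a_smul_smul (c : ℂ) (v w : E) : P.a (c • v) (c • w) = ‖c‖ ^ 2 * P.a v w := by
  rw [P.a_smul, conj_smul_smul, map_smul, smul_eq_mul]

theorem inner_M_smul_smul (c : ℂ) (v w x y : E) :
    inner ℝ (P.M (c • v) (c • w)) (P.M (c • x) (c • y)) =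
      ‖c‖ ^ 4 * inner ℝ (P.M v w) (P.M x y) := by
  rw [P.M_smul, conj_smul_smul, P.M_symm v, P.M_symm _ (c • y), P.M_smul, conj_smul_smul]
  simp only [map_smul, smul_apply, inner_smul_right]
  rw [P.M_symm w, P.M_symm y]
  ring

/-- `J` is equivariant under multiplication by complex numbers. -/
theorem J_smul_smul {c : ℂ} (hc : c ≠ 0) (u v w : E) :
    P.J (c • u) (c • v) (c • w) = ‖c‖ ^ 2 * P.J u v w := by
  have hc' : ‖c‖ ≠ 0 := norm_ne_zero_iff.2 hc
  simp only [J_apply, a_smul_smul, inner_M_smul_smul, inner_j_smul_smul, norm_j_smul]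
  by_cases hu : ‖P.j u‖ = 0
  · simp [hu]
  · field_simp

theorem Js_smul_smul (σ : ℝ) {c : ℂ} (hc : c ≠ 0) (u v w : E) :
    P.Js σ (c • u) (c • v) (c • w) = ‖c‖ ^ 2 * P.Js σ u v w := by
  rw [Js_apply, Js_apply, J_smul_smul P hc, inner_j_smul_smul]; ring

/-- Multiplication by c is a real isomorphism of E that intertwines the two operators up to the
factor ‖c‖², so invertibility is a property of the complex line only. -/
theorem bijective_Js_smul (σ : ℝ) {c : ℂ} (hc : c ≠ 0) {u : E}
    (h : Function.Bijective (P.Js σ u)) : Function.Bijective (P.Js σ (c • u)) := by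
  have hc' : ‖c‖ ^ 2 ≠ 0 := pow_ne_zero _ (norm_ne_zero_iff.2 hc)
  let S : E →L[ℝ] E := { toFun := fun v => c • v, map_add' := by simp,
                          map_smul' := fun r v => (smul_comm c r v), cont := by fun_prop }
  let S' : E →L[ℝ] E := { toFun := fun v => c⁻¹ • v, map_add' := by simp,
                          map_smul' := fun r v => (smul_comm c⁻¹ r v), cont := by fun_prop }
  have hS : ∀ v : E, c • c⁻¹ • v = v := fun (v : E) => smul_inv_smul₀ hc v
  constructor
  · rw [injective_iff_map_eq_zero]
    intro v hv
    have : c⁻¹ • v = 0 := by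
      apply (injective_iff_map_eq_zero _).1 h.1
      ext w
      have h1 := P.Js_smul_smul σ hc u (c⁻¹ • v) w
      rw [hS, hv] at h1
      simpa [hc'] using h1.symm
    rw [← hS v, this, smul_zero]
  · intro F
    obtain ⟨v, hv⟩ := h.2 ((‖c‖ ^ 2)⁻¹ • (F.comp S))
    refine ⟨c • v, ?_⟩
    ext w
    have h1 := P.Js_smul_smul σ hc u v (c⁻¹ • w)
    rw [hS, hv] at h1
    rw [h1]
    simp [S, hS, hc']

end FormData
end GPE
end

/-! ### The projection along the complex line of u, and J(u) on that line. -/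

noncomputable section

namespace GPE

namespace FormData

variable {E H G : Type*} [NormedAddCommGroup E] [NormedSpace ℝ E] [NormedSpace ℂ E]
  [IsScalarTower ℝ ℂ E] [NormedAddCommGroup H] [InnerProductSpace ℝ H]
  [NormedAddCommGroup G] [InnerProductSpace ℝ G] (P : FormData E H G)

/-- The complex coefficient of `v` along `u`. -/
def coef (u v : E) : ℂ := ⟨inner ℝ (P.j u) (P.j v), inner ℝ (P.j (Complex.I • u)) (P.j v)⟩

/-- The projection along the complex line of `u`. -/
def proj (u : E) : E →L[ℝ] E :=
  ContinuousLinearMap.id ℝ E - (P.riesz (P.j u)).smulRight u -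
    (P.riesz (P.j (Complex.I • u))).smulRight (Complex.I • u)

/-- The projection of `H` along the complex line of `u`. -/
def projH (u : E) : H →L[ℝ] H :=
  ContinuousLinearMap.id ℝ H - (ip H (P.j u)).smulRight (P.j u) -
    (ip H (P.j (Complex.I • u))).smulRight (P.j (Complex.I • u))

theorem projH_apply (u : E) (h : H) : P.projH u h = h - inner ℝ (P.j u) h • P.j u -
    inner ℝ (P.j (Complex.I • u)) h • P.j (Complex.I • u) := rfl

theorem j_proj (u v : E) : P.j (P.proj u v) = P.projH u (P.j v) := by
  simp [proj, projH]

theorem complex_smul_eq (c : ℂ) (u : E) : c • u = c.re • u + c.im • Complex.I • u := by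
  conv_lhs => rw [← Complex.re_add_im c, add_smul, mul_smul]
  congr 1
  · rw [← algebraMap_smul ℂ c.re u]; rfl
  · rw [← algebraMap_smul ℂ c.im (Complex.I • u)]; rfl

theorem proj_apply (u v : E) : P.proj u v = v - P.coef u v • u := by
  rw [complex_smul_eq]
  simp [proj, coef, sub_sub]

theorem inner_j_I_smul (u : E) : inner ℝ (P.j (Complex.I • u)) (P.j u) = 0 := by
  have h := P.j_smul Complex.I u u
  rw [Complex.conj_I, neg_smul, map_neg, inner_neg_right, real_inner_comm (P.j (Complex.I • u))] at h
  linarith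

theorem norm_j_I_smul (u : E) : ‖P.j (Complex.I • u)‖ = ‖P.j u‖ := by
  simp [norm_j_smul]

theorem inner_j_smul_left (u v : E) (c : ℂ) :
    inner ℝ (P.j (c • u)) (P.j v) =
      c.re * inner ℝ (P.j u) (P.j v) + c.im * inner ℝ (P.j (Complex.I • u)) (P.j v) := by
  rw [complex_smul_eq]
  simp [inner_add_left, inner_smul_left]

theorem coef_add (u v w : E) : P.coef u (v + w) = P.coef u v + P.coef u w := by
  apply Complex.ext <;> simp [coef, inner_add_right]

theorem coef_sub (u v w : E) : P.coef u (v - w) = P.coef u v - P.coef u w := by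
  apply Complex.ext <;> simp [coef, inner_sub_right]

theorem coef_smul (u v : E) (c : ℂ) : P.coef u (c • v) = c * P.coef u v := by
  have h1 := P.j_smul (conj c) u v
  have h2 := P.j_smul (conj c) (Complex.I • u) v
  rw [Complex.conj_conj, inner_j_smul_left] at h1 h2
  rw [smul_smul, Complex.I_mul_I, neg_smul, one_smul, map_neg, inner_neg_left] at h2
  simp only [Complex.conj_re, Complex.conj_im] at h1 h2
  apply Complex.ext
  · simp only [coef, Complex.mul_re]; linarith
  · simp only [coef, Complex.mul_im]; linarith

theorem coef_real_smul (u v : E) (r : ℝ) : P.coef u (r • v) = r * P.coef u v := by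
  rw [← coef_smul, complex_smul_eq]; simp

variable {u : E} (hu : ‖P.j u‖ = 1)
include hu

theorem coef_self : P.coef u u = 1 := by
  apply Complex.ext
  · simp [coef, hu]
  · simpa [coef] using P.inner_j_I_smul u

theorem norm_coef_le (v : E) : ‖P.coef u v‖ ≤ 2 * ‖P.j v‖ := by
  refine (Complex.norm_le_abs_re_add_abs_im _).trans ?_
  have h1 := abs_real_inner_le_norm (P.j u) (P.j v)
  have h2 := abs_real_inner_le_norm (P.j (Complex.I • u)) (P.j v)
  rw [norm_j_I_smul] at h2
  rw [hu] at h1 h2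
  simp only [coef]
  linarith

theorem coef_proj (v : E) : P.coef u (P.proj u v) = 0 := by
  rw [proj_apply, coef_sub, coef_smul, coef_self P hu, mul_one, sub_self]

theorem proj_eq_self_of_coef {v : E} (h : P.coef u v = 0) : P.proj u v = v := by
  rw [proj_apply, h, zero_smul, sub_zero]

theorem proj_smul_self (c : ℂ) : P.proj u (c • u) = 0 := by
  rw [proj_apply, coef_smul, coef_self P hu, mul_one, sub_self]

theorem projH_projH (h : H) : P.projH u (P.projH u h) = P.projH u h := by
  have e1 := P.inner_j_I_smul u
  have e2 : inner ℝ (P.j u) (P.j (Complex.I • u)) = 0 := by rw [real_inner_comm]; exact e1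
  simp only [projH_apply, inner_sub_right, inner_smul_right, e1, e2, real_inner_self_eq_norm_sq, hu,
    norm_j_I_smul]
  simp

omit hu in
theorem projH_symm (h k : H) : inner ℝ (P.projH u h) k = inner ℝ h (P.projH u k) := by
  simp only [projH_apply, inner_sub_right, inner_sub_left, inner_smul_right, inner_smul_left]
  simp only [real_inner_comm (P.j u), real_inner_comm (P.j (Complex.I • u)), RCLike.conj_to_real]
  ring

theorem inner_smul_proj (c : ℂ) (v : E) : inner ℝ (P.j (c • u)) (P.j (P.proj u v)) = 0 := by
  have h := P.coef_proj hu v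
  rw [Complex.ext_iff] at h
  simp only [coef, Complex.zero_re, Complex.zero_im] at h
  rw [inner_j_smul_left, h.1, h.2]; ring

/-- The rank one term is the only asymmetric part of J(u), and its factor (u, ·) vanishes on the
range of `proj`. -/
theorem J_proj_symm (v w : E) :
    P.J u (P.proj u v) (P.proj u w) = P.J u (P.proj u w) (P.proj u v) := by
  have h : ∀ x, inner ℝ (P.j u) (P.j (P.proj u x)) = 0 := fun x => by
    simpa using P.inner_smul_proj hu 1 x
  rw [J_apply, J_apply, P.a_symm, P.M_symm (P.proj u v), h, h,
    real_inner_comm (P.M u (P.proj u v)) (P.M u (P.proj u w))]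
  ring

variable {lam : ℝ}
  (he : ∀ w, P.a u w + P.κ * inner ℝ (P.M u u) (P.M u w) = lam * inner ℝ (P.j u) (P.j w))
include he

/-- The cubic part contributes 3κ and the rank one part -2κ, which leaves the κ of the eigenvalue
equation. -/
theorem J_self (w : E) : P.J u u w = lam * inner ℝ (P.j u) (P.j w) := by
  rw [← he, J_apply, real_inner_self_eq_norm_sq, hu]; ring

/-- In the direction iu the rank one term drops out because (u, iu) = 0, and the two cubic terms
combine with weights -1 and 2. What remains is the eigenvalue equation tested with the conjugate of
i times w. -/
theorem J_smul_self (c : ℂ) (w : E) : P.J u (c • u) w = lam * inner ℝ (P.j (c • u)) (P.j w) := by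
  have hI : P.J u (Complex.I • u) w = lam * inner ℝ (P.j (Complex.I • u)) (P.j w) := by
    have e := he (conj Complex.I • w)
    have h1 : inner ℝ (P.M u u) (P.M u (conj Complex.I • w)) =
        inner ℝ (P.M u (Complex.I • u)) (P.M u w) := by
      rw [P.M_symm u (conj Complex.I • w), real_inner_comm, P.M_smul, Complex.conj_conj,
        real_inner_comm, P.M_symm w u, P.M_symm _ u]
    have h2 : inner ℝ (P.M u u) (P.M (Complex.I • u) w) =
        -inner ℝ (P.M u (Complex.I • u)) (P.M u w) := by
      rw [real_inner_comm, P.M_smul, Complex.conj_I, neg_smul, map_neg, neg_apply,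
        inner_neg_right, real_inner_comm, P.M_symm u (Complex.I • u)]
    rw [← P.j_smul, ← P.a_smul, h1] at e
    rw [← e, J_apply, real_inner_comm (P.j (Complex.I • u)), P.inner_j_I_smul, hu, h2]
    ring
  rw [complex_smul_eq, map_add, map_smul, map_smul, add_apply, smul_apply, smul_apply, hI,
    J_self P hu he]
  simp [inner_add_left, inner_smul_left]
  ring

end FormData
end GPE
end

/-! ### The compressed inverse and its spectral bound. -/

noncomputable section

namespace GPE

namespace FormData

variable {E H G : Type*} [NormedAddCommGroup E] [NormedSpace ℝ E] [NormedSpace ℂ E]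
  [IsScalarTower ℝ ℂ E] [NormedAddCommGroup H] [InnerProductSpace ℝ H]
  [NormedAddCommGroup G] [InnerProductSpace ℝ G] (P : FormData E H G)
  (u : E) (e : E ≃L[ℝ] (E →L[ℝ] ℝ))

/-- The compression of the inverse of `e` to the complement of `u`, from `H` to `E`. -/
def resolvH : H →L[ℝ] E :=
  (P.proj u).comp ((e.symm : (E →L[ℝ] ℝ) →L[ℝ] E).comp (P.riesz.comp (P.projH u)))

/-- The compression of the inverse of `e` to the complement of `u`, on `E`. -/
def resolv : E →L[ℝ] E :=
  (P.proj u).comp ((e.symm : (E →L[ℝ] ℝ) →L[ℝ] E).comp (P.riesz.comp P.j))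

theorem resolvH_apply (h : H) :
    P.resolvH u e h = P.proj u (e.symm (P.riesz (P.projH u h))) := rfl

theorem resolv_apply (v : E) : P.resolv u e v = P.proj u (e.symm (P.riesz (P.j v))) := rfl

variable {u} {e} {σ lam : ℝ} (hu : ‖P.j u‖ = 1)
  (he : ∀ w, P.a u w + P.κ * inner ℝ (P.M u u) (P.M u w) = lam * inner ℝ (P.j u) (P.j w))
  (hes : ∀ v, e v = P.Js σ u v) (hσ : lam + σ ≠ 0)
include hu he

theorem Js_smul_self (c : ℂ) (w : E) :
    P.Js σ u (c • u) w = (lam + σ) * inner ℝ (P.j (c • u)) (P.j w) := by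
  rw [Js_apply, P.J_smul_self hu he]; ring

/-- The complex line of u consists of eigenvectors, so J_σ(u) maps it to multiples of itself, which
vanish on test vectors orthogonal to that line. -/
theorem Js_proj_right (v w : E) :
    P.Js σ u w (P.proj u v) = P.Js σ u (P.proj u w) (P.proj u v) := by
  conv_rhs => rw [P.proj_apply u w]
  rw [map_sub, sub_apply, P.Js_smul_self hu he, P.inner_smul_proj hu]
  ring

include hes

theorem Js_symm_riesz (h : H) (w : E) : P.Js σ u (e.symm (P.riesz h)) w = inner ℝ h (P.j w) := by
  rw [← hes, e.apply_symm_apply, riesz_apply]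

/-- This expresses the compressed inverse by the form of J_σ(u) on the range of `proj`, where that
form is symmetric; self-adjointness follows. -/
theorem inner_resolvH (h k : H) : inner ℝ (P.j (P.resolvH u e h)) k =
    P.Js σ u (P.resolvH u e k) (P.resolvH u e h) := by
  simp only [resolvH_apply]
  rw [← P.Js_proj_right hu he, P.Js_symm_riesz hu he hes, j_proj, ← P.projH_symm,
    P.projH_projH hu, real_inner_comm, P.projH_symm]

theorem isSelfAdjoint_resolvH [CompleteSpace H] : IsSelfAdjoint (P.j.comp (P.resolvH u e)) := by
  rw [ContinuousLinearMap.isSelfAdjoint_iff_isSymmetric]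
  intro h k
  have h1 := P.inner_resolvH hu he hes h k
  have h2 := P.inner_resolvH hu he hes k h
  simp only [ContinuousLinearMap.coe_coe, ContinuousLinearMap.comp_apply]
  rw [h1, real_inner_comm, h2]
  simp only [Js_apply, resolvH_apply]
  rw [P.J_proj_symm hu, real_inner_comm (P.j (P.proj u _))]

/-- If τ ≠ 0 is an eigenvalue of the compression, its eigenvector is j w with w in the range of
`proj`, and J_σ(u)⁻¹w = τw + zu with zu on the complex line of u. Thus J(u) is triangular on w and
zu, with diagonal entries τ⁻¹ - σ and λ. If they coincide, w is the top of a Jordan chain over u;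
otherwise the block can be diagonalized and the minimality hypothesis applies. -/
theorem norm_resolvH_le [CompleteSpace H] {m : ℝ} (hm : 0 < m)
    (hgen : ∀ w z : E, (∀ x, P.J u w x - lam * inner ℝ (P.j w) (P.j x) = inner ℝ (P.j z) (P.j x)) →
      (∀ x, P.J u z x = lam * inner ℝ (P.j z) (P.j x)) → ∃ c : ℂ, w = c • u)
    (hmin : ∀ (ν : ℝ) (v : E), v ≠ 0 → (∀ x, P.J u v x = ν * inner ℝ (P.j v) (P.j x)) →
      ν ≠ lam → m ≤ |ν + σ|) :
    ‖P.j.comp (P.resolvH u e)‖ ≤ m⁻¹ := by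
  refine norm_le_of_hasEigenvalue_le (P.isSelfAdjoint_resolvH hu he hes)
    (P.j_compact.comp_clm (P.resolvH u e)) (by positivity) ?_
  intro τ h hτ hh hTh
  set v := e.symm (P.riesz (P.projH u h)) with hv
  set w : E := τ⁻¹ • P.proj u v with hw
  have hjw : P.j w = h := by
    rw [hw, map_smul]
    change τ⁻¹ • (P.j.comp (P.resolvH u e)) h = h
    rw [hTh, inv_smul_smul₀ hτ]
  have hpw : P.proj u w = w := by
    apply P.proj_eq_self_of_coef hu
    rw [hw, coef_real_smul, P.coef_proj hu, mul_zero]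
  have hw0 : w ≠ 0 := fun h0 => hh (by rw [← hjw, h0, map_zero])
  have hph : P.projH u h = P.j w := by rw [← hjw, ← j_proj, hpw]
  obtain ⟨zu, hzu⟩ : ∃ zu : E, zu = P.coef u v • u := ⟨_, rfl⟩
  have hJz : ∀ x, P.J u zu x = lam * inner ℝ (P.j zu) (P.j x) := fun x => by
    rw [hzu, P.J_smul_self hu he]
  have hpz : P.proj u zu = 0 := by rw [hzu, P.proj_smul_self hu]
  have hvw : v = τ • w + zu := by
    rw [hw, smul_inv_smul₀ hτ, proj_apply, hzu]; abel
  have hJv : ∀ x, P.Js σ u v x = inner ℝ (P.j w) (P.j x) := fun x => by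
    rw [hv, P.Js_symm_riesz hu he hes, hph]
  have hJw : ∀ x, P.J u w x = (τ⁻¹ - σ) * inner ℝ (P.j w) (P.j x) -
      (lam + σ) * τ⁻¹ * inner ℝ (P.j zu) (P.j x) := by
    intro x
    have := hJv x
    rw [hvw, map_add, add_apply, map_smul, smul_apply, smul_eq_mul, Js_apply,
      Js_apply, hJz] at this
    field_simp
    linarith
  by_cases hν : τ⁻¹ - σ = lam
  -- Simplicity makes w a multiple of u, but w is fixed by `proj`, which annihilates such multiples.
  · exfalso
    obtain ⟨c, hc⟩ := hgen w ((-((lam + σ) * τ⁻¹) : ℝ) • zu) (fun x => by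
        rw [hJw, hν, map_smul P.j _ zu, inner_smul_left, RCLike.conj_to_real]; ring) (fun x => by
        rw [map_smul, map_smul, smul_apply, hJz, inner_smul_left,
          RCLike.conj_to_real, smul_eq_mul]; ring)
    apply hw0
    rw [← hpw, hc, P.proj_smul_self hu]
  · have hν' : lam - (τ⁻¹ - σ) ≠ 0 := sub_ne_zero.2 (Ne.symm hν)
    -- This b makes w + b • zu a true eigenvector for τ⁻¹ - σ.
    obtain ⟨b, hb⟩ : ∃ b : ℝ, b * (lam - (τ⁻¹ - σ)) = (lam + σ) * τ⁻¹ :=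
      ⟨_, div_mul_cancel₀ _ hν'⟩
    have := hmin (τ⁻¹ - σ) (w + b • zu) ?_ ?_ hν
    · rw [sub_add_cancel, abs_inv] at this
      exact (le_inv_comm₀ hm (abs_pos.2 hτ)).1 this
    · intro h0
      apply hw0
      have := congrArg (P.proj u) h0
      rwa [map_add, hpw, map_smul, hpz, smul_zero, add_zero, map_zero] at this
    · intro x
      rw [map_add, map_add, add_apply, hJw, map_smul P.j _ zu, map_smul _ _ zu, smul_apply,
        hJz, inner_add_left, inner_smul_left, RCLike.conj_to_real, smul_eq_mul]
      linear_combination inner ℝ (P.j zu) (P.j x) * hb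

include hσ in
theorem symm_riesz_smul_self (c : ℂ) :
    e.symm (P.riesz (P.j (c • u))) = (lam + σ)⁻¹ • c • u := by
  rw [ContinuousLinearEquiv.symm_apply_eq, hes]
  ext w
  rw [ContinuousLinearMap.map_smul, smul_apply, P.Js_smul_self hu he, riesz_apply, smul_eq_mul,
    inv_mul_cancel_left₀ hσ]

-- The inverse preserves the complex line of u, and the outer projection kills that line, so
-- projecting the argument first changes nothing.
include hσ in
theorem resolv_eq (v : E) : P.resolv u e v = P.resolvH u e (P.j v) := by
  rw [resolv_apply, resolvH_apply, ← j_proj]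
  rw [P.proj_apply u v, map_sub, map_sub, map_sub, P.symm_riesz_smul_self hu he hes hσ,
    map_sub, ContinuousLinearMap.map_smul, P.proj_smul_self hu, smul_zero, sub_zero]

include hσ in
theorem j_resolv_pow (k : ℕ) (v : E) :
    P.j ((P.resolv u e ^ k) v) = ((P.j.comp (P.resolvH u e)) ^ k) (P.j v) := by
  induction k with
  | zero => simp
  | succ k ih =>
    rw [pow_succ', pow_succ', mul_apply_eq_comp, mul_apply_eq_comp, ← ih,
      P.resolv_eq hu he hes hσ]
    rfl

-- The bound on T holds in the norm of H, whereas the iteration lives in E. The power k+1 on E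
-- factors as `resolvH` ∘ Tᵏ ∘ `j`, so the change of norm costs a constant independent of k; the
-- maximum with 1 covers k = 0.
include hσ in
theorem exists_norm_resolv_pow_le {r : ℝ} (hr : 0 < r)
    (hT : ‖P.j.comp (P.resolvH u e)‖ ≤ r) :
    ∃ C, ∀ k y, ‖(((lam + σ) • P.resolv u e) ^ k) y‖ ≤ C * (|lam + σ| * r) ^ k * ‖y‖ := by
  refine ⟨max 1 (‖P.resolvH u e‖ * ‖P.j‖ * r⁻¹), fun k y => ?_⟩
  rw [smul_pow, smul_apply, norm_smul, norm_pow, Real.norm_eq_abs, mul_pow]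
  have : ‖(P.resolv u e ^ k) y‖ ≤ max 1 (‖P.resolvH u e‖ * ‖P.j‖ * r⁻¹) * r ^ k * ‖y‖ := by
    cases k with
    | zero =>
      simp only [pow_zero, one_apply_eq_self, mul_one]
      exact le_mul_of_one_le_left (norm_nonneg _) (le_max_left _ _)
    | succ k =>
      rw [pow_succ', mul_apply_eq_comp, P.resolv_eq hu he hes hσ, P.j_resolv_pow hu he hes hσ]
      calc _ ≤ ‖P.resolvH u e‖ * (‖P.j.comp (P.resolvH u e)‖ ^ k * (‖P.j‖ * ‖y‖)) := by
            refine (P.resolvH u e).le_opNorm_of_le ?_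
            refine ContinuousLinearMap.le_of_opNorm_le_of_le _ ?_ (P.j.le_opNorm y)
            rcases Nat.eq_zero_or_pos k with rfl | hk
            · exact ContinuousLinearMap.norm_id_le
            · exact norm_pow_le' _ hk
        _ ≤ ‖P.resolvH u e‖ * (r ^ k * (‖P.j‖ * ‖y‖)) := by gcongr
        _ = ‖P.resolvH u e‖ * ‖P.j‖ * r⁻¹ * r ^ (k + 1) * ‖y‖ := by
            rw [pow_succ]; field_simp
        _ ≤ _ := by gcongr; exact le_max_right _ _
  calc _ ≤ |lam + σ| ^ k * (max 1 (‖P.resolvH u e‖ * ‖P.j‖ * r⁻¹) * r ^ k * ‖y‖) := by gcongr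
    _ = _ := by ring

end FormData
end GPE
end

/-! ### First order expansion of ψ at the eigenfunction. -/

noncomputable section

namespace GPE

namespace FormData

variable {E H G : Type*} [NormedAddCommGroup E] [NormedSpace ℝ E] [NormedSpace ℂ E]
  [IsScalarTower ℝ ℂ E] [NormedAddCommGroup H] [InnerProductSpace ℝ H]
  [NormedAddCommGroup G] [InnerProductSpace ℝ G] (P : FormData E H G)

theorem abs_inner_M_le (a b c d : E) :
    |inner ℝ (P.M a b) (P.M c d)| ≤ ‖P.M‖ ^ 2 * (‖a‖ * ‖b‖ * ‖c‖ * ‖d‖) := by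
  refine (abs_real_inner_le_norm _ _).trans ?_
  calc _ ≤ (‖P.M‖ * ‖a‖ * ‖b‖) * (‖P.M‖ * ‖c‖ * ‖d‖) := by
        gcongr <;> exact P.M.le_opNorm₂ _ _
    _ = _ := by ring

variable {u : E} {e : E ≃L[ℝ] (E →L[ℝ] ℝ)} {σ lam : ℝ} (hu : ‖P.j u‖ = 1)

theorem eventually_bijective_Js [CompleteSpace E] (hu0 : P.j u ≠ 0) (hes : ∀ v, e v = P.Js σ u v) :
    ∀ᶠ U in 𝓝 u, Function.Bijective (P.Js σ U) := by
  have h1 : P.Js σ u = (e : E →L[ℝ] E →L[ℝ] ℝ) := by ext v : 1; exact (hes v).symm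
  have h2 := (P.continuousAt_Js σ hu0).tendsto
  rw [h1] at h2
  filter_upwards [h2.eventually (ContinuousLinearEquiv.nhds e)] with U hU
  obtain ⟨e', he'⟩ := hU
  rw [← he']
  exact e'.bijective

theorem eventually_norm_Js_sub_lt (hu0 : P.j u ≠ 0) {η : ℝ} (hη : 0 < η) :
    ∀ᶠ U in 𝓝 u, ‖P.Js σ U - P.Js σ u‖ < η := by
  have h := (Metric.continuousAt_iff' (α := E →L[ℝ] E →L[ℝ] ℝ)).1 (P.continuousAt_Js σ hu0) η hη
  exact h.mono fun U hU =>
    (dist_eq_norm (E := E →L[ℝ] E →L[ℝ] ℝ) (P.Js σ U) (P.Js σ u)).symm.trans_lt hU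

include hu in
/-- Moving the density to second order away from `u` in a direction orthogonal to the complex line
of `u` does not change the value of `J` at `u` to first order. -/
theorem exists_J_add_self_le :
    ∃ K, 0 ≤ K ∧ ∀ y w, P.coef u y = 0 → ‖y‖ ≤ 1 →
      |P.J (u + y) u w - P.J u u w| ≤ K * ‖y‖ ^ 2 * ‖w‖ := by
  refine ⟨|P.κ| * ‖P.M‖ ^ 2 * (‖P.j‖ ^ 2 * ‖u‖ ^ 3 + (3 * ‖u‖ + 2) +
    2 * (‖P.j‖ ^ 2 * (‖u‖ + 1) ^ 3)), by positivity, fun y w hy hy1 => ?_⟩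
  have huy : inner ℝ (P.j u) (P.j y) = 0 := congrArg Complex.re hy
  set t : ℝ := 1 + ‖P.j y‖ ^ 2 with ht
  have ht1 : 1 ≤ t := by rw [ht]; nlinarith [sq_nonneg ‖P.j y‖]
  have hnt : ‖P.j (u + y)‖ ^ 2 = t := by
    rw [map_add, norm_add_sq_real, huy, hu, ht]; ring
  have hnt4 : ‖P.j (u + y)‖ ^ 4 = t ^ 2 := by rw [← hnt]; ring
  have hin : inner ℝ (P.j (u + y)) (P.j u) = 1 := by
    rw [map_add, inner_add_left, real_inner_comm (P.j u) (P.j y), huy, real_inner_self_eq_norm_sq, hu]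
    ring
  -- All terms of first order in y cancel, as they must because (J'(u)y)u = 0. Orthogonality of y to
  -- u makes 1 - t⁻¹ quadratic in y as well.
  have key : P.J (u + y) u w - P.J u u w =
      -(P.κ * (1 - t⁻¹)) * inner ℝ (P.M u u) (P.M u w) +
      P.κ * t⁻¹ * (-inner ℝ (P.M y y) (P.M u w) - 2 * inner ℝ (P.M u y) (P.M y w)
        - 2 * inner ℝ (P.M y y) (P.M y w)) +
      2 * (P.κ * (1 - t⁻¹)) * t⁻¹ * inner ℝ (P.M (u + y) (u + y)) (P.M (u + y) w) := by
    rw [J_apply, J_apply, hnt, hnt4, hin, hu, real_inner_self_eq_norm_sq, hu]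
    simp only [map_add, add_apply, inner_add_left, inner_add_right, P.M_symm y u]
    field_simp
    ring
  have hj : 1 - t⁻¹ ≤ ‖P.j‖ ^ 2 * ‖y‖ ^ 2 := by
    have h1 : 1 - t⁻¹ ≤ ‖P.j y‖ ^ 2 := by
      have h2 : 1 - t⁻¹ = (t - 1) / t := by field_simp
      rw [h2, show ‖P.j y‖ ^ 2 = t - 1 by rw [ht]; ring]
      exact div_le_self (by linarith) ht1
    exact h1.trans (by rw [← mul_pow]; gcongr; exact P.j.le_opNorm y)
  have hj0 : 0 ≤ 1 - t⁻¹ := sub_nonneg.2 (inv_le_one_of_one_le₀ ht1)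
  have hti : t⁻¹ ≤ 1 := inv_le_one_of_one_le₀ ht1
  have hti0 : 0 ≤ t⁻¹ := by positivity
  have hUy : ‖u + y‖ ≤ ‖u‖ + 1 := (norm_add_le _ _).trans (by gcongr)
  have b1 : |-(P.κ * (1 - t⁻¹)) * inner ℝ (P.M u u) (P.M u w)| ≤
      |P.κ| * ‖P.M‖ ^ 2 * (‖P.j‖ ^ 2 * ‖u‖ ^ 3) * ‖y‖ ^ 2 * ‖w‖ := by
    rw [abs_mul, abs_neg, abs_mul, abs_of_nonneg hj0]
    calc _ ≤ |P.κ| * (‖P.j‖ ^ 2 * ‖y‖ ^ 2) * (‖P.M‖ ^ 2 * (‖u‖ * ‖u‖ * ‖u‖ * ‖w‖)) := by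
          gcongr; exact P.abs_inner_M_le _ _ _ _
      _ = _ := by ring
  have b2 : |P.κ * t⁻¹ * (-inner ℝ (P.M y y) (P.M u w) - 2 * inner ℝ (P.M u y) (P.M y w)
        - 2 * inner ℝ (P.M y y) (P.M y w))| ≤
      |P.κ| * ‖P.M‖ ^ 2 * (3 * ‖u‖ + 2) * ‖y‖ ^ 2 * ‖w‖ := by
    rw [abs_mul, abs_mul, abs_of_nonneg hti0]
    have h3 : |(-inner ℝ (P.M y y) (P.M u w) - 2 * inner ℝ (P.M u y) (P.M y w)
        - 2 * inner ℝ (P.M y y) (P.M y w))| ≤ ‖P.M‖ ^ 2 * (‖y‖ * ‖y‖ * ‖u‖ * ‖w‖) +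
        2 * (‖P.M‖ ^ 2 * (‖u‖ * ‖y‖ * ‖y‖ * ‖w‖)) + 2 * (‖P.M‖ ^ 2 * (‖y‖ * ‖y‖ * 1 * ‖w‖)) := by
      have i1 := abs_le.1 (P.abs_inner_M_le y y u w)
      have i2 := abs_le.1 (P.abs_inner_M_le u y y w)
      have i3 := abs_le.1 ((P.abs_inner_M_le y y y w).trans
        (by gcongr : _ ≤ ‖P.M‖ ^ 2 * (‖y‖ * ‖y‖ * 1 * ‖w‖)))
      rw [abs_le]
      constructor <;> linarith [i1.1, i1.2, i2.1, i2.2, i3.1, i3.2]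
    calc _ ≤ |P.κ| * 1 * (‖P.M‖ ^ 2 * (‖y‖ * ‖y‖ * ‖u‖ * ‖w‖) +
        2 * (‖P.M‖ ^ 2 * (‖u‖ * ‖y‖ * ‖y‖ * ‖w‖)) + 2 * (‖P.M‖ ^ 2 * (‖y‖ * ‖y‖ * 1 * ‖w‖))) := by
          gcongr
      _ = _ := by ring
  have b3 : |2 * (P.κ * (1 - t⁻¹)) * t⁻¹ * inner ℝ (P.M (u + y) (u + y)) (P.M (u + y) w)| ≤
      |P.κ| * ‖P.M‖ ^ 2 * (2 * (‖P.j‖ ^ 2 * (‖u‖ + 1) ^ 3)) * ‖y‖ ^ 2 * ‖w‖ := by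
    rw [abs_mul, abs_mul, abs_mul, abs_mul, abs_of_nonneg hj0, abs_of_nonneg hti0, abs_two]
    calc _ ≤ 2 * (|P.κ| * (‖P.j‖ ^ 2 * ‖y‖ ^ 2)) * 1 *
          (‖P.M‖ ^ 2 * ((‖u‖ + 1) * (‖u‖ + 1) * (‖u‖ + 1) * ‖w‖)) := by
          gcongr
          exact (P.abs_inner_M_le _ _ _ _).trans (by gcongr)
      _ = _ := by ring
  rw [key]
  calc _ ≤ _ := (abs_add_le _ _).trans (add_le_add ((abs_add_le _ _).trans (add_le_add b1 b2)) b3)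
    _ = _ := by ring

variable (he : ∀ w, P.a u w + P.κ * inner ℝ (P.M u u) (P.M u w) = lam * inner ℝ (P.j u) (P.j w))
  (hes : ∀ v, e v = P.Js σ u v) (hσ : lam + σ ≠ 0)
include hu he hes hσ

/-- First order expansion of `ψ` at `u`. -/
theorem eventually_norm_psi_sub_le {η : ℝ} (hη : 0 < η) :
    ∃ δ, 0 < δ ∧ ∀ y, ‖y‖ < δ → P.coef u y = 0 →
      ∀ v, (∀ w, P.Js σ (u + y) v w = inner ℝ (P.j (u + y)) (P.j w)) →
      ‖v - ((lam + σ)⁻¹ • u + e.symm (P.riesz (P.j y)))‖ ≤ η * ‖y‖ := by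
  have hu0 : P.j u ≠ 0 := by rw [← norm_ne_zero_iff, hu]; exact one_ne_zero
  obtain ⟨K, hK, hJ⟩ := P.exists_J_add_self_le hu
  obtain ⟨B, hB0, hBe⟩ : ∃ B, 0 ≤ B ∧ ∀ F, ‖e.symm F‖ ≤ B * ‖F‖ :=
    ⟨‖(e.symm : (E →L[ℝ] ℝ) →L[ℝ] E)‖, ContinuousLinearMap.opNorm_nonneg _,
      (e.symm : (E →L[ℝ] ℝ) →L[ℝ] E).le_opNorm⟩
  obtain ⟨D, hD0, hD⟩ : ∃ D, 0 ≤ D ∧ ∀ y, ‖P.riesz (P.j y)‖ ≤ D * ‖y‖ :=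
    ⟨‖P.riesz.comp P.j‖, ContinuousLinearMap.opNorm_nonneg _, (P.riesz.comp P.j).le_opNorm⟩
  -- The first entry lets the perturbation of J_σ be absorbed (Bζ ≤ 1/2); the second gives the error
  -- ζ‖p‖ half of the budget η‖y‖. The other half is reserved for the quadratic term and fixes the
  -- last entry of δ.
  set ζ := min (1 / (2 * (B + 1))) (η / (4 * (B + 1) * (B + 1) * (D + 1))) with hζ
  have hζ0 : 0 < ζ := by positivity
  obtain ⟨δ₁, hδ₁, h1⟩ := Metric.eventually_nhds_iff.1
    (P.eventually_norm_Js_sub_lt (σ := σ) hu0 hζ0)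
  refine ⟨min (min δ₁ 1) (η / (4 * (B + 1) * (|lam + σ|⁻¹ * K + 1))), by positivity, ?_⟩
  intro y hy hy0 v hv
  rw [lt_min_iff, lt_min_iff] at hy
  obtain ⟨⟨hy1, hy2⟩, hy3⟩ := hy
  set U := u + y with hU
  have hclose : ‖P.Js σ U - P.Js σ u‖ < ζ := h1 (by rw [dist_eq_norm, hU]; simpa using hy1)
  set p := e.symm (P.riesz (P.j y)) with hp
  have hpn : ‖p‖ ≤ B * (D * ‖y‖) := (hBe _).trans (by gcongr; exact hD y)
  set x := v - ((lam + σ)⁻¹ • u + p) with hx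
  have hep : P.Js σ u p = P.riesz (P.j y) := by rw [← hes, hp, e.apply_symm_apply]
  -- Equation for the error x of the expansion: the first term is quadratic in y, the second a small
  -- operator applied to p = O(‖y‖).
  have hxw : P.Js σ U x = -((lam + σ)⁻¹ • (P.J U u - P.J u u)) - (P.Js σ U - P.Js σ u) p := by
    ext w
    have e1 : P.Js σ U v w = inner ℝ (P.j u) (P.j w) + inner ℝ (P.j y) (P.j w) := by
      rw [hv, hU, map_add, inner_add_left]
    have e2 := congrArg (fun F => F w) hep
    have e3 := P.J_self hu he w
    simp only [riesz_apply] at e2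
    simp only [hx, map_sub, map_add, map_smul, sub_apply, add_apply, smul_apply, neg_apply,
      smul_eq_mul, e1, e2, e3]
    rw [P.Js_apply σ U u w]
    field_simp
    ring
  have hr1 : ‖P.J U u - P.J u u‖ ≤ K * ‖y‖ ^ 2 := by
    refine ContinuousLinearMap.opNorm_le_bound _ (by positivity) fun w => ?_
    exact hJ y w hy0 hy2.le
  have hr2 : ‖P.Js σ U x‖ ≤ |lam + σ|⁻¹ * (K * ‖y‖ ^ 2) + ζ * (B * (D * ‖y‖)) := by
    rw [hxw]
    refine (norm_sub_le _ _).trans (add_le_add ?_ ?_)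
    · rw [norm_neg, norm_smul, norm_inv, Real.norm_eq_abs]; gcongr
    · exact ContinuousLinearMap.le_of_opNorm_le_of_le _ hclose.le hpn
  -- Only the inverse at u is bounded a priori; the difference of the operators at U and u goes to
  -- the right and is absorbed in `hx2`.
  have hx1 : ‖x‖ ≤ B * (‖P.Js σ U x‖ + ζ * ‖x‖) := by
    have e4 : e x = P.Js σ U x - (P.Js σ U - P.Js σ u) x := by rw [hes]; simp
    calc ‖x‖ = ‖e.symm (e x)‖ := by rw [e.symm_apply_apply]
      _ ≤ B * ‖e x‖ := hBe _
      _ ≤ _ := by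
        gcongr
        rw [e4]
        refine (norm_sub_le _ _).trans ?_
        gcongr
        exact ContinuousLinearMap.le_of_opNorm_le _ hclose.le x
  have hz1 : B * ζ ≤ 1 / 2 := by
    have : ζ * (2 * (B + 1)) ≤ 1 := by
      rw [← le_div_iff₀ (by positivity)]; exact min_le_left _ _
    nlinarith
  have hz2 : ζ * (4 * (B + 1) * (B + 1) * (D + 1)) ≤ η := by
    rw [← le_div_iff₀ (by positivity)]; exact min_le_right _ _
  have hy4 : ‖y‖ * (4 * (B + 1) * (|lam + σ|⁻¹ * K + 1)) ≤ η := by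
    rw [← le_div_iff₀ (by positivity)]; exact hy3.le
  have hx2 : ‖x‖ ≤ 2 * B * ‖P.Js σ U x‖ := by nlinarith [norm_nonneg x]
  have hl : 0 ≤ |lam + σ|⁻¹ := by positivity
  set l := |lam + σ|⁻¹
  have f1 : 4 * B * (l * K * ‖y‖) ≤ η := by
    refine le_trans ?_ hy4
    have : 0 ≤ l * K := by positivity
    nlinarith [norm_nonneg y, mul_nonneg this (norm_nonneg y), mul_nonneg hB0 (norm_nonneg y)]
  have f2 : 4 * B * (ζ * (B * D)) ≤ η := by
    refine le_trans ?_ hz2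
    have : B * (B * D) ≤ (B + 1) * (B + 1) * (D + 1) := by
      have : 0 ≤ B * D := by positivity
      nlinarith
    nlinarith
  calc ‖x‖ ≤ 2 * B * (l * (K * ‖y‖ ^ 2) + ζ * (B * (D * ‖y‖))) := hx2.trans (by gcongr)
    _ = (4 * B * (l * K * ‖y‖) / 2 + 4 * B * (ζ * (B * D)) / 2) * ‖y‖ := by ring
    _ ≤ _ := by gcongr; linarith

end FormData
end GPE
end

/-! ### One step in the projective chart: contraction and change of phase. -/

noncomputable section

namespace GPE

namespace FormData

variable {E H G : Type*} [NormedAddCommGroup E] [NormedSpace ℝ E] [NormedSpace ℂ E]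
  [IsScalarTower ℝ ℂ E] [NormedAddCommGroup H] [InnerProductSpace ℝ H]
  [NormedAddCommGroup G] [InnerProductSpace ℝ G] (P : FormData E H G)

theorem proj_smul (u v : E) (c : ℂ) : P.proj u (c • v) = c • P.proj u v := by
  rw [proj_apply, proj_apply, coef_smul, mul_smul, smul_sub]

/-- The affine coordinate of `v` in the projective space of complex lines, centred at `u`. -/
def chart (u v : E) : E := (P.coef u v)⁻¹ • P.proj u v

theorem chart_smul {u v : E} {c : ℂ} (hc : c ≠ 0) : P.chart u (c • v) = P.chart u v := by
  rw [chart, chart, coef_smul, proj_smul, smul_smul, mul_inv, mul_right_comm, inv_mul_cancel₀ hc,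
    one_mul]

theorem eq_smul_add_chart {u v : E} (h : P.coef u v ≠ 0) :
    v = P.coef u v • (u + P.chart u v) := by
  rw [chart, smul_add, smul_inv_smul₀ h, proj_apply]; abel

variable {u : E} {e : E ≃L[ℝ] (E →L[ℝ] ℝ)} {σ lam : ℝ} (hu : ‖P.j u‖ = 1)
include hu

theorem coef_chart (v : E) : P.coef u (P.chart u v) = 0 := by
  rw [chart, coef_smul, P.coef_proj hu, mul_zero]

variable
  (he : ∀ w, P.a u w + P.κ * inner ℝ (P.M u u) (P.M u w) = lam * inner ℝ (P.j u) (P.j w))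
  (hes : ∀ v, e v = P.Js σ u v) (hσ : lam + σ ≠ 0)
include he hes hσ

/-- One step of the iteration near `u`, in the projective coordinate. -/
theorem exists_contraction [CompleteSpace E] {ρ θ : ℝ} (hρ : 0 ≤ ρ) (hθ : ρ < θ)
    (hL : ∃ C, ∀ k y, ‖(((lam + σ) • P.resolv u e) ^ k) y‖ ≤ C * ρ ^ k * ‖y‖) :
    ∃ (N : E → ℝ) (K δ K₁ : ℝ), 0 < K ∧ 0 < δ ∧ 0 < K₁ ∧ (∀ y, ‖y‖ ≤ N y) ∧
      (∀ y, N y ≤ K * ‖y‖) ∧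
      ∀ y, P.coef u y = 0 → N y < δ → Function.Bijective (P.Js σ (u + y)) ∧
        ∀ v, (∀ w, P.Js σ (u + y) v w = inner ℝ (P.j (u + y)) (P.j w)) →
          ‖(lam + σ) * P.coef u v - 1‖ ≤ K₁ * N y ∧ ‖(lam + σ) * P.coef u v - 1‖ ≤ 1 / 2 ∧
          N (P.chart u v) ≤ θ * N y := by
  obtain ⟨C, hC⟩ := hL
  have hu0 : P.j u ≠ 0 := by rw [← norm_ne_zero_iff, hu]; exact one_ne_zero
  set L := (lam + σ) • P.resolv u e with hLdef
  obtain ⟨N, K, hK, hNadd, hN1, hN2, hNL⟩ := exists_adapted_norm L hρ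
    (by linarith : ρ < (ρ + θ) / 2) hC
  obtain ⟨B, hB0, hB⟩ : ∃ B, 0 ≤ B ∧ ∀ y, ‖e.symm (P.riesz (P.j y))‖ ≤ B * ‖y‖ :=
    ⟨‖(e.symm : (E →L[ℝ] ℝ) →L[ℝ] E).comp (P.riesz.comp P.j)‖,
      ContinuousLinearMap.opNorm_nonneg _,
      ((e.symm : (E →L[ℝ] ℝ) →L[ℝ] E).comp (P.riesz.comp P.j)).le_opNorm⟩
  set l := |lam + σ| with hl
  have hl0 : 0 < l := abs_pos.2 hσ
  set K₁ := l * (2 * (‖P.j‖ * (B + 1))) + 1 with hK₁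
  have hK₁0 : 0 < K₁ := by positivity
  -- The adapted norm contracts L with factor (ρ+θ)/2. The remaining gap g is shared equally between
  -- the error of normalizing by ζ and the error x of the expansion.
  set g := (θ - ρ) / 2 with hg
  have hg0 : 0 < g := by rw [hg]; linarith
  set η := min 1 (g / (4 * K * (l * ‖P.proj u‖ + 1))) with hη
  have hη0 : 0 < η := by positivity
  obtain ⟨δ₁, hδ₁, h1⟩ := P.eventually_norm_psi_sub_le hu he hes hσ hη0
  obtain ⟨δ₂, hδ₂, h2⟩ := Metric.eventually_nhds_iff.1 (P.eventually_bijective_Js hu0 hes)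
  refine ⟨N, K, min (min δ₁ δ₂) (min (1 / (2 * K₁)) (g / (4 * K * (K₁ * ‖L‖ + 1)))), K₁, hK,
    by positivity, hK₁0, hN1, hN2, fun y hy hNy => ?_⟩
  have hyn := hN1 y
  rw [lt_min_iff, lt_min_iff, lt_min_iff] at hNy
  obtain ⟨⟨hy1, hy2⟩, hy3, hy4⟩ := hNy
  rw [lt_div_iff₀ (by positivity)] at hy3 hy4
  refine ⟨h2 (by rw [dist_eq_norm]; simpa using hyn.trans_lt hy2), fun v hv => ?_⟩
  have hx := h1 y (hyn.trans_lt hy1) hy v hv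
  obtain ⟨x, hxdef⟩ : ∃ x, x = v - ((lam + σ)⁻¹ • u + e.symm (P.riesz (P.j y))) := ⟨_, rfl⟩
  rw [← hxdef] at hx
  have hveq : v = (lam + σ)⁻¹ • u + (e.symm (P.riesz (P.j y)) + x) := by rw [hxdef]; abel
  have hx1 : ‖x‖ ≤ ‖y‖ := hx.trans (mul_le_of_le_one_left (norm_nonneg _) (min_le_left _ _))
  have hσc : (lam + σ : ℂ) ≠ 0 := by exact_mod_cast hσ
  -- Normalized so that ζ = 1 at y = 0; it controls both the division in the chart and the turn of
  -- the phase.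
  set ζ : ℂ := (lam + σ) * P.coef u v with hζ
  have hζ1 : ζ - 1 = (lam + σ) * P.coef u (e.symm (P.riesz (P.j y)) + x) := by
    rw [hζ, hveq, coef_add, coef_real_smul, P.coef_self hu]
    push_cast
    field_simp
    ring
  have hζ2 : ‖ζ - 1‖ ≤ K₁ * ‖y‖ := by
    rw [hζ1, norm_mul]
    have : ‖(lam + σ : ℂ)‖ = l := by rw [hl, ← Real.norm_eq_abs, ← Complex.norm_real]; simp
    rw [this]
    calc _ ≤ l * (2 * (‖P.j‖ * ((B + 1) * ‖y‖))) := by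
          gcongr
          refine (P.norm_coef_le hu _).trans ?_
          gcongr
          refine P.j.le_opNorm_of_le ?_
          rw [add_mul, one_mul]
          exact (norm_add_le _ _).trans (add_le_add (hB y) hx1)
      _ ≤ K₁ * ‖y‖ := by rw [hK₁]; nlinarith [norm_nonneg y]
  have hζ3 : ‖ζ - 1‖ ≤ K₁ * N y := hζ2.trans (by gcongr)
  have hζ4 : ‖ζ - 1‖ ≤ 1 / 2 := hζ3.trans (by linarith)
  refine ⟨hζ3, hζ4, ?_⟩
  have hζ5 : 1 / 2 ≤ ‖ζ‖ := by
    have := norm_sub_norm_le (1 : ℂ) ζ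
    rw [norm_one, norm_sub_rev] at this
    linarith
  have hζ0 : ζ ≠ 0 := by rw [← norm_pos_iff]; linarith
  have hζi : ‖ζ⁻¹‖ ≤ 2 := by
    rw [norm_inv]; exact inv_le_of_inv_le₀ (by norm_num) (by linarith)
  have hproj : (lam + σ) • P.proj u v = L y + (lam + σ) • P.proj u x := by
    rw [hveq, map_add, map_add, map_smul, hLdef, smul_apply, resolv_apply]
    have := P.proj_smul_self hu 1
    rw [one_smul] at this
    rw [this, smul_zero, zero_add, smul_add]
  -- The real factor λ+σ cancels in the chart, leaving the linearization L y, a quadratic term and a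
  -- term of size η‖y‖.
  have hchart : P.chart u v = L y + ((ζ⁻¹ - 1) • L y + ζ⁻¹ • (lam + σ) • P.proj u x) := by
    have : P.chart u v = ζ⁻¹ • (lam + σ) • P.proj u v := by
      rw [chart, hζ, ← algebraMap_smul ℂ (lam + σ), smul_smul]
      congr 1
      simp only [Complex.coe_algebraMap, Complex.ofReal_add]
      field_simp
    rw [this, hproj, smul_add, sub_smul, one_smul]; abel
  have hζi1 : ‖ζ⁻¹ - 1‖ ≤ 2 * (K₁ * N y) := by
    have : ζ⁻¹ - 1 = ζ⁻¹ * -(ζ - 1) := by field_simp; ring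
    rw [this, norm_mul, norm_neg]
    gcongr
  have hNy0 : 0 ≤ N y := (norm_nonneg _).trans hyn
  have hrem : ‖(ζ⁻¹ - 1) • L y + ζ⁻¹ • (lam + σ) • P.proj u x‖ ≤
      2 * (K₁ * N y) * (‖L‖ * N y) + 2 * (l * (‖P.proj u‖ * (η * N y))) := by
    refine (norm_add_le _ _).trans (add_le_add ?_ ?_)
    · rw [norm_smul]
      gcongr
      exact L.le_opNorm_of_le hyn
    · rw [norm_smul, norm_smul, Real.norm_eq_abs]
      gcongr
      refine (P.proj u).le_opNorm_of_le (hx.trans (by gcongr))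
  have hη2 : η * (4 * K * (l * ‖P.proj u‖ + 1)) ≤ g := by
    rw [← le_div_iff₀ (by positivity)]; exact min_le_right _ _
  rw [hchart]
  have c1 : K * (2 * (K₁ * N y) * ‖L‖) ≤ g / 2 := by nlinarith [mul_nonneg hK.le hNy0]
  have c2 : K * (2 * (l * (‖P.proj u‖ * η))) ≤ g / 2 := by nlinarith [mul_nonneg hK.le hη0.le]
  calc _ ≤ (ρ + θ) / 2 * N y + K * (2 * (K₁ * N y) * (‖L‖ * N y) +
        2 * (l * (‖P.proj u‖ * (η * N y)))) :=
        (hNadd _ _).trans (add_le_add (hNL y) ((hN2 _).trans (by gcongr)))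
    _ = ((ρ + θ) / 2 + (K * (2 * (K₁ * N y) * ‖L‖) + K * (2 * (l * (‖P.proj u‖ * η))))) * N y := by
        ring
    _ ≤ θ * N y := by gcongr; linarith

omit hu he hes hσ in
theorem norm_div_norm_sub_one_le {ζ : ℂ} (h : ‖ζ - 1‖ ≤ 1 / 2) : ‖ζ / ‖ζ‖ - 1‖ ≤ 4 * ‖ζ - 1‖ := by
  have h1 := norm_sub_norm_le (1 : ℂ) ζ
  have h2 := abs_norm_sub_norm_le ζ 1
  rw [norm_one, norm_sub_rev] at h1
  rw [norm_one] at h2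
  have h3 : 1 / 2 ≤ ‖ζ‖ := by linarith
  have h4 : (‖ζ‖ : ℂ) ≠ 0 := by
    have : ‖ζ‖ ≠ 0 := by linarith
    exact_mod_cast this
  have h5 : ζ / ‖ζ‖ - 1 = ((ζ - 1) - ((‖ζ‖ - 1 : ℝ) : ℂ)) / ‖ζ‖ := by
    push_cast; field_simp; ring
  rw [h5, norm_div, Complex.norm_real, norm_norm, div_le_iff₀ (by linarith)]
  refine (norm_sub_le _ _).trans ?_
  rw [Complex.norm_real, Real.norm_eq_abs]
  nlinarith [norm_nonneg (ζ - 1)]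

-- The positive factor r does not affect the phase, and the sign turns λ+σ into its modulus, so the
-- phase of z is multiplied exactly by the phase of ζ.
omit he hes in
theorem phase_step {z z' ζ c : ℂ} {r : ℝ} (hr : 0 < r) (hz : z ≠ 0) (hζ : ζ = (lam + σ) * c)
    (hζ1 : ‖ζ - 1‖ ≤ 1 / 2) (hz' : z' = r * (z * c)) :
    ‖(Real.sign (lam + σ) : ℂ) * (z' / ‖z'‖) - z / ‖z‖‖ ≤ 4 * ‖ζ - 1‖ := by
  have hzn : (‖z‖ : ℂ) ≠ 0 := by exact_mod_cast norm_ne_zero_iff.2 hz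
  have hrc : (r : ℂ) ≠ 0 := by exact_mod_cast hr.ne'
  have hσc : (lam + σ : ℂ) ≠ 0 := by exact_mod_cast hσ
  have hlc : ((|lam + σ| : ℝ) : ℂ) ≠ 0 := by exact_mod_cast (abs_pos.2 hσ).ne'
  have hζ0 : ζ ≠ 0 := by
    rintro rfl; norm_num at hζ1
  have hc : c ≠ 0 := by rintro rfl; simp at hζ; exact hζ0 hζ
  have hcn : (‖c‖ : ℂ) ≠ 0 := by exact_mod_cast norm_ne_zero_iff.2 hc
  have e1 : (Real.sign (lam + σ) : ℂ) * ((|lam + σ| : ℝ) : ℂ) = lam + σ := by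
    rw [← Complex.ofReal_mul]
    rcases hσ.lt_or_gt with h | h
    · rw [Real.sign_of_neg h, abs_of_neg h]; push_cast; ring
    · rw [Real.sign_of_pos h, abs_of_pos h]; push_cast; ring
  have e3 : ‖ζ‖ = |lam + σ| * ‖c‖ := by
    rw [hζ, norm_mul, ← Complex.ofReal_add, Complex.norm_real, Real.norm_eq_abs]
  have e2 : (Real.sign (lam + σ) : ℂ) * (z' / ‖z'‖) - z / ‖z‖ = z / ‖z‖ * (ζ / ‖ζ‖ - 1) := by
    rw [e3, hz', norm_mul, norm_mul, Complex.norm_real, Real.norm_eq_abs, abs_of_pos hr, hζ, ← e1]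
    push_cast
    field_simp
  rw [e2, norm_mul, norm_div, Complex.norm_real, norm_norm, div_self (norm_ne_zero_iff.2 hz),
    one_mul]
  exact norm_div_norm_sub_one_le hζ1

end FormData
end GPE
end

/-! ### Convergence of the abstract iteration. -/

noncomputable section

namespace GPE

namespace FormData

variable {E H G : Type*} [NormedAddCommGroup E] [NormedSpace ℝ E] [NormedSpace ℂ E]
  [IsScalarTower ℝ ℂ E] [NormedAddCommGroup H] [InnerProductSpace ℝ H]
  [NormedAddCommGroup G] [InnerProductSpace ℝ G] (P : FormData E H G)

/-- A bijective `J(u) + σ I` as an isomorphism of `E` onto its dual. -/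
def equivJs [CompleteSpace E] {σ : ℝ} {u : E} (h : Function.Bijective (P.Js σ u)) :
    E ≃L[ℝ] (E →L[ℝ] ℝ) :=
  ContinuousLinearEquiv.ofBijective (P.Js σ u)
    (LinearMap.ker_eq_bot.2 h.1) (LinearMap.range_eq_top.2 h.2)

theorem equivJs_apply [CompleteSpace E] {σ : ℝ} {u : E} (h : Function.Bijective (P.Js σ u))
    (v : E) : P.equivJs h v = P.Js σ u v := rfl

theorem exists_norm_le_of_bijective [CompleteSpace E] {σ : ℝ} {u : E}
    (h : Function.Bijective (P.Js σ u)) :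
    ∃ C : ℝ, ∀ (F : E →L[ℝ] ℝ) (v : E), (∀ w, P.Js σ u v w = F w) → ‖v‖ ≤ C * ‖F‖ := by
  refine ⟨‖((P.equivJs h).symm : (E →L[ℝ] ℝ) →L[ℝ] E)‖, fun F v hv => ?_⟩
  have : v = (P.equivJs h).symm F :=
    (P.equivJs h).eq_symm_apply.2 (ContinuousLinearMap.ext hv)
  rw [this]
  exact ContinuousLinearMap.le_opNorm ((P.equivJs h).symm : (E →L[ℝ] ℝ) →L[ℝ] E) F

variable {u : E} {e : E ≃L[ℝ] (E →L[ℝ] ℝ)} {σ lam : ℝ} (hu : ‖P.j u‖ = 1)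

/-- `V` is the normalized image of `U` under one step of the shifted `J`-method, if that step is
well defined. -/
def IsStep (σ : ℝ) (U V : E) : Prop :=
  Function.Bijective (P.Js σ U) → ∀ v, (∀ w, P.Js σ U v w = inner ℝ (P.j U) (P.j w)) → V = ‖P.j v‖⁻¹ • v

include hu in
/-- Transport of one step near `u` to an arbitrary complex multiple. -/
theorem exists_chart_step (hσ : lam + σ ≠ 0) {U V : E} (hU : P.coef u U ≠ 0)
    (hV : P.IsStep σ U V) (hb : Function.Bijective (P.Js σ (u + P.chart u U))) :
    ∃ v, (∀ w, P.Js σ (u + P.chart u U) v w = inner ℝ (P.j (u + P.chart u U)) (P.j w)) ∧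
      (‖(lam + σ) * P.coef u v - 1‖ ≤ 1 / 2 → P.coef u V ≠ 0 ∧ ‖P.j V‖ = 1 ∧
        P.chart u V = P.chart u v ∧
        ‖(Real.sign (lam + σ) : ℂ) * (P.coef u V / ‖P.coef u V‖) - P.coef u U / ‖P.coef u U‖‖ ≤
          4 * ‖(lam + σ) * P.coef u v - 1‖) := by
  obtain ⟨v, hv⟩ := hb.2 (P.riesz (P.j (u + P.chart u U)))
  have hv' : ∀ w, P.Js σ (u + P.chart u U) v w = inner ℝ (P.j (u + P.chart u U)) (P.j w) :=
    fun w => by rw [hv, riesz_apply]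
  refine ⟨v, hv', fun h1 => ?_⟩
  set z := P.coef u U
  -- By equivariance z • v solves the equation at U = z • (u + `chart u U`), so `IsStep` identifies
  -- V.
  have hVv : V = ‖P.j (z • v)‖⁻¹ • z • v := by
    have hUe : U = z • (u + P.chart u U) := P.eq_smul_add_chart hU
    apply hV
    · rw [hUe]
      exact P.bijective_Js_smul σ hU hb
    intro w
    have hw : w = z • z⁻¹ • w := (smul_inv_smul₀ hU w).symm
    rw [hw, hUe, P.Js_smul_smul σ hU, hv', ← P.inner_j_smul_smul, ← hUe]
  have hc : P.coef u v ≠ 0 := by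
    intro h0
    rw [h0] at h1; norm_num at h1
  have hv0 : v ≠ 0 := by
    rintro rfl
    apply hc; apply Complex.ext <;> simp [coef]
  have hjv : ‖P.j (z • v)‖ ≠ 0 := by
    rw [norm_j_smul]
    refine mul_ne_zero (norm_ne_zero_iff.2 hU) (norm_ne_zero_iff.2 fun h0 => hv0 ?_)
    exact P.j_injective (h0.trans (map_zero _).symm)
  have hr : 0 < ‖P.j (z • v)‖⁻¹ := by positivity
  have hcV : P.coef u V = (‖P.j (z • v)‖⁻¹ : ℝ) * (z * P.coef u v) := by
    rw [hVv, coef_real_smul, coef_smul]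
  have hrc : ((‖P.j (z • v)‖⁻¹ : ℝ) : ℂ) ≠ 0 := by exact_mod_cast hr.ne'
  refine ⟨?_, ?_, ?_, ?_⟩
  · rw [hcV]; exact mul_ne_zero hrc (mul_ne_zero hU hc)
  · rw [hVv, map_smul, norm_smul, norm_inv, norm_norm, inv_mul_cancel₀ hjv]
  · rw [hVv, ← algebraMap_smul ℂ (‖P.j (z • v)‖⁻¹ : ℝ)]
    exact (P.chart_smul hrc).trans (P.chart_smul hU)
  · exact P.phase_step hu hσ hr hU rfl h1 hcV

variable
  (he : ∀ w, P.a u w + P.κ * inner ℝ (P.M u u) (P.M u w) = lam * inner ℝ (P.j u) (P.j w))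
  (hes : ∀ v, e v = P.Js σ u v) (hσ : lam + σ ≠ 0)

-- The modulus of the coefficient is not tracked through the iteration: normalization forces it to
-- equal 1/‖j(u + y)‖, with y the chart coordinate of V.
include hu in
theorem abs_norm_coef_sub_one_le {V : E} (hV : P.coef u V ≠ 0) (h1 : ‖P.j V‖ = 1) :
    |‖P.coef u V‖ - 1| ≤ 2 * ‖P.j‖ * ‖P.chart u V‖ := by
  have h2 := P.norm_coef_le hu V
  rw [h1, mul_one] at h2
  have h3 : ‖P.coef u V‖ * ‖P.j (u + P.chart u V)‖ = 1 := by
    rw [← norm_j_smul, ← P.eq_smul_add_chart hV, h1]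
  have h4 := abs_norm_sub_norm_le (P.j (u + P.chart u V)) (P.j u)
  rw [hu, ← map_sub, add_sub_cancel_left] at h4
  have h5 : ‖P.coef u V‖ - 1 = -(‖P.coef u V‖ * (‖P.j (u + P.chart u V)‖ - 1)) := by
    rw [mul_sub, h3]; ring
  rw [h5, abs_neg, abs_mul, abs_norm, mul_assoc]
  gcongr
  exact h4.trans (P.j.le_opNorm _)

include hu he hes hσ

/-- Local convergence of the shifted `J`-method, in terms of the linearized operator. -/
theorem exists_convergence_of_power_bound [CompleteSpace E] {ρ θ : ℝ} (hρ : 0 ≤ ρ) (hθ : ρ < θ)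
    (hθ1 : θ < 1) (hL : ∃ C, ∀ k y, ‖(((lam + σ) • P.resolv u e) ^ k) y‖ ≤ C * ρ ^ k * ‖y‖) :
    ∃ δ C : ℝ, 0 < δ ∧ 0 < C ∧ ∀ U : ℕ → E, ‖U 0 - u‖ < δ → (∀ n, P.IsStep σ (U n) (U (n + 1))) →
      (∀ n, Function.Bijective (P.Js σ (U n))) ∧ ∃ c : ℂ, ‖c‖ = 1 ∧
        ∀ n, ‖Real.sign (lam + σ) ^ n • U n - c • u‖ ≤ C * θ ^ n * ‖U 0 - u‖ := by
  obtain ⟨N, K, δ, K₁, hK, hδ, hK₁, hN1, hN2, hstep⟩ := P.exists_contraction hu he hes hσ hρ hθ hL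
  have hθ0 : 0 < θ := hρ.trans_lt hθ
  have h1θ : 0 < 1 - θ := by linarith
  set A := 2 * K * ‖P.proj u‖ with hA
  have hA0 : 0 ≤ A := by positivity
  set B := 2 * ‖P.j‖ with hB
  have hB0 : 0 ≤ B := by positivity
  -- The first radius keeps the initial coefficient within 1/2 of 1; the second places the initial
  -- chart coordinate in the domain of the contraction.
  refine ⟨min (1 / (2 * (B + 1))) (δ / (A + 1)),
    (B + B * A + 4 * K₁ * A / (1 - θ)) * ‖u‖ + (2 + A) * A + 1, by positivity, by positivity,
    fun U hU0 hU => ?_⟩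
  set d := ‖U 0 - u‖ with hd
  have hd0 : 0 ≤ d := norm_nonneg _
  rw [lt_min_iff, lt_div_iff₀ (by positivity), lt_div_iff₀ (by positivity)] at hU0
  obtain ⟨hd1, hd2⟩ := hU0
  have hz0 : ‖P.coef u (U 0) - 1‖ ≤ B * d := by
    rw [← P.coef_self hu, ← coef_sub, hB, mul_assoc]
    exact (P.norm_coef_le hu _).trans (by gcongr; exact P.j.le_opNorm _)
  have hz0' : ‖P.coef u (U 0) - 1‖ ≤ 1 / 2 := hz0.trans (by nlinarith)
  have hz0n : 1 / 2 ≤ ‖P.coef u (U 0)‖ := by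
    have := norm_sub_norm_le (1 : ℂ) (P.coef u (U 0))
    rw [norm_one, norm_sub_rev] at this
    linarith
  have hz0n2 : |‖P.coef u (U 0)‖ - 1| ≤ B * d := by
    have := abs_norm_sub_norm_le (P.coef u (U 0)) 1
    rw [norm_one] at this
    exact this.trans hz0
  have hy0 : N (P.chart u (U 0)) ≤ A * d := by
    refine (hN2 _).trans ?_
    have e0 : P.proj u (U 0) = P.proj u (U 0 - u) := by
      have := P.proj_smul_self hu 1
      rw [one_smul] at this
      rw [map_sub, this, sub_zero]
    rw [chart, norm_smul, norm_inv, e0, hA]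
    calc _ ≤ K * (2 * (‖P.proj u‖ * d)) := by
          gcongr
          · exact inv_le_of_inv_le₀ (by norm_num) (by linarith)
          · exact (P.proj u).le_opNorm _
      _ = _ := by ring
  -- The summand B * d in the bound on the modulus is needed only at n = 0, because the initial
  -- value is not assumed normalized.
  have main : ∀ n, P.coef u (U n) ≠ 0 ∧ N (P.chart u (U n)) ≤ θ ^ n * (A * d) ∧
      |‖P.coef u (U n)‖ - 1| ≤ θ ^ n * (B * d + B * (A * d)) ∧
      Function.Bijective (P.Js σ (U n)) ∧
      ‖(Real.sign (lam + σ) : ℂ) * (P.coef u (U (n + 1)) / ‖P.coef u (U (n + 1))‖) -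
        P.coef u (U n) / ‖P.coef u (U n)‖‖ ≤ 4 * K₁ * (A * d) * θ ^ n := by
    have aux : ∀ n, P.coef u (U n) ≠ 0 → N (P.chart u (U n)) ≤ θ ^ n * (A * d) →
        Function.Bijective (P.Js σ (U n)) ∧
        ‖(Real.sign (lam + σ) : ℂ) * (P.coef u (U (n + 1)) / ‖P.coef u (U (n + 1))‖) -
          P.coef u (U n) / ‖P.coef u (U n)‖‖ ≤ 4 * K₁ * (A * d) * θ ^ n ∧
        P.coef u (U (n + 1)) ≠ 0 ∧ N (P.chart u (U (n + 1))) ≤ θ ^ (n + 1) * (A * d) ∧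
        |‖P.coef u (U (n + 1))‖ - 1| ≤ θ ^ (n + 1) * (B * (A * d)) := by
      intro n h0 hN
      have hθn : θ ^ n ≤ 1 := pow_le_one₀ hθ0.le hθ1.le
      have hlt : N (P.chart u (U n)) < δ := by
        have : θ ^ n * (A * d) ≤ A * d := mul_le_of_le_one_left (by positivity) hθn
        nlinarith
      obtain ⟨hb, hs⟩ := hstep _ (P.coef_chart hu (U n)) hlt
      obtain ⟨v, hv, hv2⟩ := P.exists_chart_step hu hσ h0 (hU n) hb
      obtain ⟨s1, s2, s3⟩ := hs v hv
      obtain ⟨t1, t2, t3, t4⟩ := hv2 s2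
      have hN' : N (P.chart u (U (n + 1))) ≤ θ ^ (n + 1) * (A * d) := by
        rw [t3, pow_succ']
        calc _ ≤ θ * (θ ^ n * (A * d)) := s3.trans (by gcongr)
          _ = _ := by ring
      refine ⟨?_, ?_, t1, hN', ?_⟩
      · rw [P.eq_smul_add_chart h0]
        exact P.bijective_Js_smul σ h0 hb
      · calc _ ≤ 4 * (K₁ * (θ ^ n * (A * d))) := t4.trans (by gcongr; exact s1.trans (by gcongr))
          _ = _ := by ring
      · calc _ ≤ B * (θ ^ (n + 1) * (A * d)) :=
              (P.abs_norm_coef_sub_one_le hu t1 t2).trans (by gcongr; exact (hN1 _).trans hN')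
          _ = _ := by ring
    intro n
    induction n with
    | zero =>
      have h0 : P.coef u (U 0) ≠ 0 := by rw [← norm_pos_iff]; linarith
      have hN0 : N (P.chart u (U 0)) ≤ θ ^ 0 * (A * d) := by simpa using hy0
      obtain ⟨a1, a2, -⟩ := aux 0 h0 hN0
      refine ⟨h0, hN0, ?_, a1, a2⟩
      rw [pow_zero, one_mul]
      exact hz0n2.trans (le_add_of_nonneg_right (by positivity))
    | succ n ih =>
      obtain ⟨-, -, b1, b2, b3⟩ := aux n ih.1 ih.2.1
      obtain ⟨a1, a2, -⟩ := aux (n + 1) b1 b2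
      refine ⟨b1, b2, b3.trans ?_, a1, a2⟩
      gcongr
      exact le_add_of_nonneg_left (by positivity)
  refine ⟨fun n => (main n).2.2.2.1, ?_⟩
  set s : ℂ := (Real.sign (lam + σ) : ℂ) with hs
  have hsn : ‖s‖ = 1 := by
    rw [hs, Complex.norm_real]
    rcases hσ.lt_or_gt with h | h
    · rw [Real.sign_of_neg h]; norm_num
    · rw [Real.sign_of_pos h]; norm_num
  -- Sign-corrected phases: unimodular with geometrically decaying increments, hence convergent to a
  -- unimodular c at the same rate.
  set p : ℕ → ℂ := fun n => s ^ n * (P.coef u (U n) / ‖P.coef u (U n)‖) with hp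
  have hpn : ∀ n, ‖p n‖ = 1 := fun n => by
    rw [hp]
    simp only [norm_mul, norm_pow, hsn, one_pow, one_mul, norm_div, Complex.norm_real, norm_norm]
    exact div_self (norm_ne_zero_iff.2 (main n).1)
  have hpd : ∀ n, dist (p n) (p (n + 1)) ≤ 4 * K₁ * (A * d) * θ ^ n := fun n => by
    rw [dist_comm, dist_eq_norm]
    have : p (n + 1) - p n = s ^ n * (s * (P.coef u (U (n + 1)) / ‖P.coef u (U (n + 1))‖) -
        P.coef u (U n) / ‖P.coef u (U n)‖) := by simp only [hp]; ring
    rw [this, norm_mul, norm_pow, hsn, one_pow, one_mul]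
    exact (main n).2.2.2.2
  obtain ⟨c, hc⟩ := cauchySeq_tendsto_of_complete (cauchySeq_of_le_geometric _ _ hθ1 hpd)
  have hpc : ∀ n, ‖p n - c‖ ≤ 4 * K₁ * (A * d) * θ ^ n / (1 - θ) := fun n => by
    rw [← dist_eq_norm]
    exact dist_le_of_le_geometric_of_tendsto _ _ hθ1 hpd hc n
  refine ⟨c, ?_, fun n => ?_⟩
  · refine tendsto_nhds_unique hc.norm ?_
    simp only [hpn]
    exact tendsto_const_nhds
  obtain ⟨m1, m2, m3, -, -⟩ := main n
  set z := P.coef u (U n) with hz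
  have e1 : Real.sign (lam + σ) ^ n • U n - c • u =
      (s ^ n * z - c) • u + (s ^ n * z) • P.chart u (U n) := by
    have : Real.sign (lam + σ) ^ n • U n = s ^ n • z • (u + P.chart u (U n)) := by
      rw [hz, ← P.eq_smul_add_chart m1, ← algebraMap_smul ℂ (Real.sign (lam + σ) ^ n)]
      simp [hs]
    rw [this, smul_smul, smul_add, sub_smul]; abel
  have e2 : ‖s ^ n * z - p n‖ ≤ θ ^ n * (B * d + B * (A * d)) := by
    have : s ^ n * z - p n = p n * ((‖z‖ - 1 : ℝ) : ℂ) := by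
      have : (‖z‖ : ℂ) ≠ 0 := by exact_mod_cast norm_ne_zero_iff.2 m1
      simp only [hp, ← hz]; push_cast; field_simp
    rw [this, norm_mul, hpn, one_mul, Complex.norm_real]
    exact m3
  have e4 : ‖s ^ n * z‖ ≤ 2 + A := by
    rw [norm_mul, norm_pow, hsn, one_pow, one_mul]
    have h1 : θ ^ n * (B * d + B * (A * d)) ≤ B * d + B * (A * d) :=
      mul_le_of_le_one_left (by positivity) (pow_le_one₀ hθ0.le hθ1.le)
    have h2 : B * d ≤ 1 := by nlinarith
    have h3 := (abs_le.1 m3).2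
    nlinarith
  have e5 : ‖s ^ n * z - c‖ ≤ θ ^ n * (B * d + B * (A * d)) + 4 * K₁ * (A * d) * θ ^ n / (1 - θ) := by
    rw [← sub_add_sub_cancel _ (p n)]
    exact (norm_add_le _ _).trans (add_le_add e2 (hpc n))
  rw [e1]
  calc _ ≤ (θ ^ n * (B * d + B * (A * d)) + 4 * K₁ * (A * d) * θ ^ n / (1 - θ)) * ‖u‖ +
        (2 + A) * (θ ^ n * (A * d)) := by
        refine (norm_add_le _ _).trans (add_le_add ?_ ?_)
        · rw [norm_smul]; gcongr
        · rw [norm_smul]; gcongr; exact (hN1 _).trans m2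
    _ = ((B + B * A + 4 * K₁ * A / (1 - θ)) * ‖u‖ + (2 + A) * A) * θ ^ n * d := by ring
    _ ≤ _ := by
        have h1 : 0 ≤ θ ^ n * d := by positivity
        linarith

/-- Local convergence of the shifted `J`-method, in terms of the eigenvalues of `J(u)`. -/
theorem exists_convergence [CompleteSpace E] [CompleteSpace H] {m θ : ℝ} (hm : 0 < m)
    (hgen : ∀ w z : E, (∀ x, P.J u w x - lam * inner ℝ (P.j w) (P.j x) = inner ℝ (P.j z) (P.j x)) →
      (∀ x, P.J u z x = lam * inner ℝ (P.j z) (P.j x)) → ∃ c : ℂ, w = c • u)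
    (hmin : ∀ (ν : ℝ) (v : E), v ≠ 0 → (∀ x, P.J u v x = ν * inner ℝ (P.j v) (P.j x)) →
      ν ≠ lam → m ≤ |ν + σ|) (hθ : |lam + σ| / m < θ) (hθ1 : θ < 1) :
    ∃ δ C : ℝ, 0 < δ ∧ 0 < C ∧ ∀ U : ℕ → E, ‖U 0 - u‖ < δ → (∀ n, P.IsStep σ (U n) (U (n + 1))) →
      (∀ n, Function.Bijective (P.Js σ (U n))) ∧ ∃ c : ℂ, ‖c‖ = 1 ∧
        ∀ n, ‖Real.sign (lam + σ) ^ n • U n - c • u‖ ≤ C * θ ^ n * ‖U 0 - u‖ :=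
  P.exists_convergence_of_power_bound hu he hes hσ (by positivity) hθ hθ1
    (P.exists_norm_resolv_pow_le hu he hes hσ (inv_pos.2 hm)
      (P.norm_resolvH_le hu he hes hm hgen hmin))

end FormData
end GPE
end

/-! ### Sobolev and Poincaré inequalities for test functions. -/

noncomputable section

namespace GPE

variable {d : ℕ} {D : Set (Pt d)}

/-- Smooth functions with compact support in `D`. -/
def IsTest (D : Set (Pt d)) (f : Pt d → ℂ) : Prop :=
  ContDiff ℝ ∞ f ∧ HasCompactSupport f ∧ tsupport f ⊆ D

/-- Cauchy-Schwarz in ℂ^d, with a regarded as a complex vector, gives the bound without a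
dimensional constant. -/
theorem norm_fderiv_apply_le (f : Pt d → ℂ) (x a : Pt d) :
    ‖fderiv ℝ f x a‖ ≤ ‖a‖ * ‖classicalGrad f x‖ := by
  have h1 : fderiv ℝ f x a = ∑ k, (a k : ℂ) * fderiv ℝ f x (EuclideanSpace.single k (1 : ℝ)) := by
    conv_lhs => rw [← (EuclideanSpace.basisFun (Fin d) ℝ).sum_repr a]
    simp
  rw [h1]
  have h2 := norm_inner_le_norm (𝕜 := ℂ)
    (WithLp.toLp 2 (fun k => (a k : ℂ)) : EuclideanSpace ℂ (Fin d)) (classicalGrad f x)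
  have h3 : ‖(WithLp.toLp 2 (fun k => (a k : ℂ)) : EuclideanSpace ℂ (Fin d))‖ = ‖a‖ := by
    simp [EuclideanSpace.norm_eq]
  rw [h3] at h2
  refine le_trans (le_of_eq ?_) h2
  congr 1
  simp [PiLp.inner_apply, classicalGrad, mul_comm]

theorem norm_fderiv_le (f : Pt d → ℂ) (x : Pt d) :
    ‖fderiv ℝ f x‖ ≤ ‖classicalGrad f x‖ :=
  ContinuousLinearMap.opNorm_le_bound _ (norm_nonneg _) fun a => by
    rw [mul_comm]; exact norm_fderiv_apply_le f x a

theorem continuous_classicalGrad {f : Pt d → ℂ} (hf : ContDiff ℝ ∞ f) :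
    Continuous (classicalGrad f) := by
  have h : Continuous (fderiv ℝ f) := hf.continuous_fderiv (by simp)
  unfold classicalGrad
  fun_prop

theorem classicalGrad_add {f g : Pt d → ℂ} (hf : ContDiff ℝ ∞ f) (hg : ContDiff ℝ ∞ g) (x : Pt d) :
    classicalGrad (f + g) x = classicalGrad f x + classicalGrad g x := by
  ext k
  simp only [classicalGrad, PiLp.add_apply]
  rw [fderiv_add ((hf.differentiable (by simp)) x) ((hg.differentiable (by simp)) x)]
  rfl

theorem classicalGrad_smul {f : Pt d → ℂ} (hf : ContDiff ℝ ∞ f) (c : ℂ) (x : Pt d) :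
    classicalGrad (c • f) x = c • classicalGrad f x := by
  ext k
  simp only [classicalGrad, PiLp.smul_apply]
  rw [fderiv_const_smul ((hf.differentiable (by simp)) x)]
  rfl

/-- The test pairs form a subspace. -/
def testSubmodule (D : Set (Pt d)) : Submodule ℂ (WithLp 2 (L2 D × L2Vec D)) where
  carrier := testPairs D
  zero_mem' := by
    refine ⟨0, contDiff_const, HasCompactSupport.zero, by simp [tsupport], ?_, ?_⟩
    · exact Lp.coeFn_zero ℂ 2 (volume.restrict D)
    · refine (Lp.coeFn_zero (EuclideanSpace ℂ (Fin d)) 2 (volume.restrict D)).trans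
        (Eventually.of_forall fun x => ?_)
      ext k
      simp [classicalGrad]
  add_mem' := by
    rintro p q ⟨f, hf1, hf2, hf3, hf4, hf5⟩ ⟨g, hg1, hg2, hg3, hg4, hg5⟩
    refine ⟨f + g, hf1.add hg1, hf2.add hg2, ?_, ?_, ?_⟩
    · exact (tsupport_add f g).trans (Set.union_subset hf3 hg3)
    · filter_upwards [Lp.coeFn_add p.fst q.fst, hf4, hg4] with x h1 h2 h3
      rw [WithLp.add_fst, h1, Pi.add_apply, h2, h3]; rfl
    · filter_upwards [Lp.coeFn_add p.snd q.snd, hf5, hg5] with x h1 h2 h3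
      rw [WithLp.add_snd, h1, Pi.add_apply, h2, h3, classicalGrad_add hf1 hg1]
  smul_mem' := by
    rintro c p ⟨f, hf1, hf2, hf3, hf4, hf5⟩
    refine ⟨c • f, contDiff_const.smul hf1, hf2.smul_left, ?_, ?_, ?_⟩
    · exact (tsupport_smul_subset_right (fun _ => c) f).trans hf3
    · filter_upwards [Lp.coeFn_smul c p.fst, hf4] with x h1 h2
      rw [WithLp.smul_fst, h1, Pi.smul_apply, h2]; rfl
    · filter_upwards [Lp.coeFn_smul c p.snd, hf5] with x h1 h2
      rw [WithLp.smul_snd, h1, Pi.smul_apply, h2, classicalGrad_smul hf1]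

theorem H10_le (D : Set (Pt d)) : H10 D ≤ (testSubmodule D).topologicalClosure := by
  refine Submodule.topologicalClosure_mono (Submodule.span_le.2 fun p hp => hp)

/-- Every element of `H¹₀` is the limit of a sequence of test pairs. -/
theorem exists_seq_testPairs (v : H10 D) :
    ∃ p : ℕ → WithLp 2 (L2 D × L2Vec D), (∀ n, p n ∈ testPairs D) ∧ Tendsto p atTop (𝓝 v) :=
  mem_closure_iff_seq_limit.1 (H10_le D v.2)

theorem IsTest.support_subset {f : Pt d → ℂ} (hf : IsTest D f) : Function.support f ⊆ D :=
  (subset_tsupport f).trans hf.2.2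

theorem IsTest.support_classicalGrad_subset {f : Pt d → ℂ} (hf : IsTest D f) :
    Function.support (classicalGrad f) ⊆ D := by
  refine subset_trans (fun x hx => ?_) ((support_fderiv_subset ℝ (f := f)).trans hf.2.2)
  rw [Function.mem_support] at hx ⊢
  rintro h0
  apply hx
  ext k
  simp [classicalGrad, h0]

/-- Gagliardo-Nirenberg-Sobolev. It requires p < d, which excludes p = 2 in the plane; there p = 4/3
has Sobolev exponent exactly 4, and Hölder on the bounded set returns to L². In dimension three p =
2 reaches 6 > 4. -/
theorem exists_eLpNorm_four_le (hd : d = 2 ∨ d = 3) (hD : MeasurableSet D)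
    (hDb : Bornology.IsBounded D) :
    ∃ C : NNReal, ∀ f, IsTest D f → eLpNorm f 4 (volume.restrict D) ≤
      C * eLpNorm (classicalGrad f) 2 (volume.restrict D) := by
  have hfin : volume D < ⊤ := hDb.measure_lt_top
  have hle : ∀ (f : Pt d → ℂ) (p : ENNReal), eLpNorm (fderiv ℝ f) p volume ≤
      eLpNorm (classicalGrad f) p volume := fun f p =>
    eLpNorm_mono (norm_fderiv_le f)
  have hr1 : ∀ f p, IsTest D f → eLpNorm f p (volume.restrict D) = eLpNorm f p volume :=
    fun f p hf => eLpNorm_restrict_eq_of_support_subset hf.support_subset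
  have hr2 : ∀ f p, IsTest D f → eLpNorm (classicalGrad f) p (volume.restrict D) =
      eLpNorm (classicalGrad f) p volume :=
    fun f p hf => eLpNorm_restrict_eq_of_support_subset hf.support_classicalGrad_subset
  rcases hd with rfl | rfl
  · obtain ⟨C, hC⟩ : ∃ C : NNReal, ∀ f, IsTest D f →
        eLpNorm f 4 volume ≤ C * eLpNorm (fderiv ℝ f) ((4 / 3 : NNReal) : ENNReal) volume :=
      ⟨_, fun f hf => by
        have := eLpNorm_le_eLpNorm_fderiv_of_le (F := ℂ) (volume : Measure (Pt 2))
          (hf.1.of_le (by simp)) hf.support_subset (p := 4 / 3) (q := 4) ?_ ?_ ?_ hDb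
        · exact_mod_cast this
        · rw [← NNReal.coe_le_coe]; push_cast; norm_num
        · rw [← NNReal.coe_lt_coe]; push_cast; simp; norm_num
        · push_cast; simp; norm_num⟩
    have hm : (volume.restrict D) Set.univ ^ (1 / ((4 / 3 : NNReal) : ENNReal).toReal -
        1 / (2 : ENNReal).toReal) ≠ ⊤ := by
      refine ENNReal.rpow_ne_top_of_nonneg (by norm_num) ?_
      rw [Measure.restrict_apply_univ]; exact hfin.ne
    lift (volume.restrict D) Set.univ ^ (1 / ((4 / 3 : NNReal) : ENNReal).toReal -
        1 / (2 : ENNReal).toReal) to NNReal using hm with b hb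
    refine ⟨C * b, fun f hf => ?_⟩
    rw [hr1 f _ hf]
    refine (hC f hf).trans ?_
    rw [ENNReal.coe_mul, mul_assoc]
    gcongr
    refine (hle f _).trans ?_
    rw [← hr2 f _ hf, mul_comm, hb]
    refine eLpNorm_le_eLpNorm_mul_rpow_measure_univ ?_
      (continuous_classicalGrad hf.1).aestronglyMeasurable
    rw [show (2 : ENNReal) = ((2 : NNReal) : ENNReal) by rfl]
    rw [ENNReal.coe_le_coe, ← NNReal.coe_le_coe]
    push_cast; norm_num
  · obtain ⟨C, hC⟩ : ∃ C : NNReal, ∀ f, IsTest D f →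
        eLpNorm f 4 volume ≤ C * eLpNorm (fderiv ℝ f) 2 volume :=
      ⟨_, fun f hf => by
        have := eLpNorm_le_eLpNorm_fderiv_of_le (F := ℂ) (volume : Measure (Pt 3))
          (hf.1.of_le (by simp)) hf.support_subset (p := 2) (q := 4) ?_ ?_ ?_ hDb
        · exact_mod_cast this
        · rw [← NNReal.coe_le_coe]; push_cast; norm_num
        · rw [← NNReal.coe_lt_coe]; push_cast; simp; norm_num
        · push_cast; simp; norm_num⟩
    refine ⟨C, fun f hf => ?_⟩
    rw [hr1 f _ hf, hr2 f _ hf]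
    refine (hC f hf).trans ?_
    gcongr
    exact hle f 2

/-- Poincaré's inequality, read off from the L⁴ bound because D has finite measure. -/
theorem exists_eLpNorm_two_le (hd : d = 2 ∨ d = 3) (hD : MeasurableSet D)
    (hDb : Bornology.IsBounded D) :
    ∃ C : NNReal, ∀ f, IsTest D f → eLpNorm f 2 (volume.restrict D) ≤
      C * eLpNorm (classicalGrad f) 2 (volume.restrict D) := by
  obtain ⟨C, hC⟩ := exists_eLpNorm_four_le hd hD hDb
  have hm : (volume.restrict D) Set.univ ^ (1 / (2 : ENNReal).toReal -
      1 / (4 : ENNReal).toReal) ≠ ⊤ := by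
    refine ENNReal.rpow_ne_top_of_nonneg (by norm_num) ?_
    rw [Measure.restrict_apply_univ]; exact hDb.measure_lt_top.ne
  lift (volume.restrict D) Set.univ ^ (1 / (2 : ENNReal).toReal -
      1 / (4 : ENNReal).toReal) to NNReal using hm with b hb
  refine ⟨b * C, fun f hf => ?_⟩
  rw [ENNReal.coe_mul, mul_assoc]
  refine le_trans ?_ (mul_le_mul_right (hC f hf) _)
  rw [mul_comm, hb]
  exact eLpNorm_le_eLpNorm_mul_rpow_measure_univ (by norm_num)
    hf.1.continuous.aestronglyMeasurable

end GPE
end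

/-! ### Passage of the inequalities to the closure H¹₀. -/

noncomputable section

namespace GPE

variable {d : ℕ} {D : Set (Pt d)}

instance : CompleteSpace (H10 D) := by
  unfold H10
  infer_instance

/-- The underlying function, as a continuous linear map. -/
def fnL (D : Set (Pt d)) : H10 D →L[ℝ] L2 D :=
  ((WithLp.fstL 2 ℂ (L2 D) (L2Vec D)).comp (H10 D).subtypeL).restrictScalars ℝ

theorem fnL_apply (v : H10 D) : fnL D v = fn v := rfl

theorem fn_smul (c : ℂ) (v : H10 D) : fn (c • v) = c • fn v := rfl

theorem norm_sq_eq (v : H10 D) : ‖v‖ ^ 2 = ‖fn v‖ ^ 2 + ‖grad v‖ ^ 2 :=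
  WithLp.prod_norm_sq_eq_of_L2 (v : WithLp 2 (L2 D × L2Vec D))

theorem exists_norm_fn_le (hd : d = 2 ∨ d = 3) (hD : MeasurableSet D)
    (hDb : Bornology.IsBounded D) : ∃ C : NNReal, ∀ v : H10 D, ‖fn v‖ ≤ C * ‖grad v‖ := by
  obtain ⟨C, hC⟩ := exists_eLpNorm_two_le hd hD hDb
  refine ⟨C, fun v => ?_⟩
  obtain ⟨p, hp, hpv⟩ := exists_seq_testPairs v
  have h1 : Tendsto (fun n => ‖(p n).fst‖) atTop (𝓝 ‖fn v‖) :=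
    (((WithLp.continuous_fst 2 (L2 D) (L2Vec D)).tendsto _).comp hpv).norm
  have h2 : Tendsto (fun n => ‖(p n).snd‖) atTop (𝓝 ‖grad v‖) :=
    (((WithLp.continuous_snd 2 (L2 D) (L2Vec D)).tendsto _).comp hpv).norm
  refine le_of_tendsto_of_tendsto' h1 (h2.const_mul (C : ℝ)) fun n => ?_
  obtain ⟨f, hf1, hf2, hf3, hf4, hf5⟩ := hp n
  have := hC f ⟨hf1, hf2, hf3⟩
  rw [← eLpNorm_congr_ae hf4, ← eLpNorm_congr_ae hf5, ← Lp.enorm_def, ← Lp.enorm_def] at this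
  simp only [enorm_eq_nnnorm] at this
  exact_mod_cast this

/-- The approximating functions converge only in L², so an almost everywhere convergent subsequence
and Fatou's lemma carry the L⁴ bound to the limit. -/
theorem exists_eLpNorm_fn_four_le (hd : d = 2 ∨ d = 3) (hD : MeasurableSet D)
    (hDb : Bornology.IsBounded D) : ∃ C : NNReal, ∀ v : H10 D,
      eLpNorm (fn v) 4 (volume.restrict D) ≤ C * ‖grad v‖ₑ := by
  obtain ⟨C, hC⟩ := exists_eLpNorm_four_le hd hD hDb
  refine ⟨C, fun v => ?_⟩
  obtain ⟨p, hp, hpv⟩ := exists_seq_testPairs v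
  have h1 : Tendsto (fun n => (p n).fst) atTop (𝓝 (fn v)) :=
    ((WithLp.continuous_fst 2 (L2 D) (L2Vec D)).tendsto _).comp hpv
  have h2 : Tendsto (fun n => ‖(p n).snd‖ₑ) atTop (𝓝 ‖grad v‖ₑ) :=
    (continuous_enorm.tendsto _).comp (((WithLp.continuous_snd 2 (L2 D) (L2Vec D)).tendsto _).comp hpv)
  obtain ⟨ns, hns, hae⟩ := (tendstoInMeasure_of_tendsto_Lp h1).exists_seq_tendsto_ae
  refine (Lp.eLpNorm_lim_le_liminf_eLpNorm (fun n => Lp.aestronglyMeasurable (p (ns n)).fst) _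
    hae).trans ?_
  have h3 : Tendsto (fun n => (C : ENNReal) * ‖(p (ns n)).snd‖ₑ) atTop (𝓝 (C * ‖grad v‖ₑ)) :=
    ENNReal.Tendsto.const_mul (h2.comp hns.tendsto_atTop) (Or.inr ENNReal.coe_ne_top)
  rw [← h3.liminf_eq]
  refine liminf_le_liminf (Eventually.of_forall fun n => ?_)
  obtain ⟨f, hf1, hf2, hf3, hf4, hf5⟩ := hp (ns n)
  have := hC f ⟨hf1, hf2, hf3⟩
  rwa [← eLpNorm_congr_ae hf4, ← eLpNorm_congr_ae hf5, ← Lp.enorm_def] at this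

end GPE
end

/-! ### Rellich's theorem by averaging over balls. -/

noncomputable section

namespace GPE

variable {d : ℕ} {D : Set (Pt d)}

/-- Jensen's inequality for the square, for a possibly unnormalized measure. -/
theorem sq_lintegral_le {α : Type*} [MeasurableSpace α] (μ : Measure α) {g : α → ENNReal}
    (hg : AEMeasurable g μ) : (∫⁻ x, g x ∂μ) ^ 2 ≤ μ Set.univ * ∫⁻ x, g x ^ 2 ∂μ := by
  have h := ENNReal.lintegral_mul_le_Lp_mul_Lq μ Real.HolderConjugate.two_two
    (aemeasurable_const (b := (1 : ENNReal))) hg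
  simp only [Pi.mul_apply, one_mul, ENNReal.one_rpow, lintegral_const] at h
  have hr : ∀ x : ENNReal, (x ^ (1 / 2 : ℝ)) ^ 2 = x := fun x => by
    rw [← ENNReal.rpow_natCast, ← ENNReal.rpow_mul]; norm_num
  calc _ ≤ (_ : ENNReal) ^ 2 := pow_le_pow_left' h 2
    _ = _ := by
      rw [mul_pow, hr, hr]
      norm_num

/-- The `L²` modulus of continuity under translations. -/
theorem lintegral_translate_sub_le {f : Pt d → ℂ} (hf : ContDiff ℝ ∞ f) (a : Pt d) :
    ∫⁻ x, ‖f (x + a) - f x‖ₑ ^ 2 ≤ ‖a‖ₑ ^ 2 * ∫⁻ x, ‖classicalGrad f x‖ₑ ^ 2 := by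
  have hc : Continuous (classicalGrad f) := continuous_classicalGrad hf
  -- Fundamental theorem of calculus along the segment, then Jensen. Tonelli and translation
  -- invariance finish the estimate below.
  have hpt : ∀ x, ‖f (x + a) - f x‖ₑ ^ 2 ≤
      ‖a‖ₑ ^ 2 * ∫⁻ t in Set.Ioc (0 : ℝ) 1, ‖classicalGrad f (x + t • a)‖ₑ ^ 2 := by
    intro x
    have hd : ∀ t : ℝ, HasDerivAt (fun t : ℝ => f (x + t • a)) (fderiv ℝ f (x + t • a) a) t := by
      intro t
      have h1 : HasDerivAt (fun t : ℝ => x + t • a) a t := by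
        simpa using ((hasDerivAt_id t).smul_const a).const_add x
      exact ((hf.differentiable (by simp)) _).hasFDerivAt.comp_hasDerivAt t h1
    have hcd : Continuous (fun t : ℝ => fderiv ℝ f (x + t • a) a) := by
      have : Continuous (fderiv ℝ f) := hf.continuous_fderiv (by simp)
      fun_prop
    have h2 := intervalIntegral.integral_eq_sub_of_hasDerivAt (a := 0) (b := 1)
      (fun t _ => hd t) (hcd.intervalIntegrable _ _)
    rw [intervalIntegral.integral_of_le zero_le_one] at h2
    simp only [one_smul, zero_smul, add_zero] at h2
    rw [← h2]
    have h3 : ‖∫ t in Set.Ioc (0 : ℝ) 1, fderiv ℝ f (x + t • a) a‖ₑ ≤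
        ∫⁻ t in Set.Ioc (0 : ℝ) 1, ‖a‖ₑ * ‖classicalGrad f (x + t • a)‖ₑ := by
      refine (enorm_integral_le_lintegral_enorm _).trans (lintegral_mono fun t => ?_)
      rw [← enorm_norm a, ← enorm_norm (classicalGrad f _), ← enorm_mul, enorm_le_iff_norm_le,
        norm_mul, norm_norm, norm_norm]
      exact norm_fderiv_apply_le f _ a
    have hm : Continuous fun t : ℝ => ‖classicalGrad f (x + t • a)‖ₑ := by fun_prop
    rw [lintegral_const_mul _ hm.measurable] at h3
    refine (pow_le_pow_left' h3 2).trans ?_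
    rw [mul_pow]
    gcongr
    refine (sq_lintegral_le _ hm.aemeasurable).trans ?_
    simp
  calc _ ≤ ∫⁻ x, ‖a‖ₑ ^ 2 * ∫⁻ t in Set.Ioc (0 : ℝ) 1, ‖classicalGrad f (x + t • a)‖ₑ ^ 2 :=
        lintegral_mono hpt
    _ = ‖a‖ₑ ^ 2 * ∫⁻ x, ∫⁻ t in Set.Ioc (0 : ℝ) 1, ‖classicalGrad f (x + t • a)‖ₑ ^ 2 := by
        rw [lintegral_const_mul']
        simp
    _ = ‖a‖ₑ ^ 2 * ∫⁻ t in Set.Ioc (0 : ℝ) 1, ∫⁻ x, ‖classicalGrad f (x + t • a)‖ₑ ^ 2 := by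
        rw [lintegral_lintegral_swap]
        refine Continuous.aemeasurable ?_
        unfold Function.uncurry
        fun_prop
    _ = _ := by
        have : ∀ t : ℝ, ∫⁻ x, ‖classicalGrad f (x + t • a)‖ₑ ^ 2 =
            ∫⁻ x, ‖classicalGrad f x‖ₑ ^ 2 := fun t =>
          lintegral_add_right_eq_self (fun x => ‖classicalGrad f x‖ₑ ^ 2) (t • a)
        simp [this]

theorem eLpNorm_two_sq {α F : Type*} [MeasurableSpace α] [NormedAddCommGroup F] (μ : Measure α)
    (f : α → F) : eLpNorm f 2 μ ^ 2 = ∫⁻ x, ‖f x‖ₑ ^ 2 ∂μ := by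
  have := eLpNorm_nnreal_pow_eq_lintegral (f := f) (μ := μ) (p := 2) two_ne_zero
  simpa using this

/-- The average of `f` over any ball near `x` is close to `f x`, in the mean. -/
theorem enorm_sub_average_sq_le {f : Pt d → ℂ} (hf : Continuous f) {h : ℝ} (hh : 0 < h)
    {x y : Pt d} (hxy : dist x y < h) :
    ‖f x - ((volume (Metric.ball (0 : Pt d) h)).toReal⁻¹ : ℝ) • ∫ z in Metric.ball y h, f z‖ₑ ^ 2 ≤
      (volume (Metric.ball (0 : Pt d) h))⁻¹ *
        ∫⁻ a in Metric.ball (0 : Pt d) (2 * h), ‖f (x + a) - f x‖ₑ ^ 2 := by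
  set c := volume (Metric.ball (0 : Pt d) h) with hc
  have hc0 : c ≠ 0 := (Metric.measure_ball_pos _ _ hh).ne'
  have hct : c ≠ ⊤ := measure_ball_lt_top.ne
  have hcr : c.toReal ≠ 0 := ENNReal.toReal_ne_zero.2 ⟨hc0, hct⟩
  have hcy : volume (Metric.ball y h) = c := Measure.addHaar_ball_center _ _ _
  have hint : IntegrableOn f (Metric.ball y h) :=
    (hf.locallyIntegrable.integrableOn_isCompact (isCompact_closedBall y h)).mono_set
      Metric.ball_subset_closedBall
  have h1 : f x - (c.toReal⁻¹ : ℝ) • ∫ z in Metric.ball y h, f z =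
      (c.toReal⁻¹ : ℝ) • ∫ z in Metric.ball y h, (f x - f z) := by
    rw [integral_sub (integrable_const_iff.2 (Or.inr ⟨by simp [hcy, hct.lt_top]⟩)) hint,
      setIntegral_const, smul_sub, measureReal_def, hcy, smul_smul, inv_mul_cancel₀ hcr, one_smul]
  have h2 : ‖(c.toReal⁻¹ : ℝ)‖ₑ = c⁻¹ := by
    rw [Real.enorm_eq_ofReal (by positivity), ← ENNReal.toReal_inv, ENNReal.ofReal_toReal]
    exact ENNReal.inv_ne_top.2 hc0
  rw [h1, enorm_smul, h2, mul_pow]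
  have h3 : ‖∫ z in Metric.ball y h, (f x - f z)‖ₑ ^ 2 ≤
      c * ∫⁻ z in Metric.ball y h, ‖f x - f z‖ₑ ^ 2 := by
    refine (pow_le_pow_left' (enorm_integral_le_lintegral_enorm _) 2).trans ?_
    refine (sq_lintegral_le _ ?_).trans ?_
    · have : Continuous fun z => ‖f x - f z‖ₑ := by fun_prop
      exact this.aemeasurable
    · rw [Measure.restrict_apply_univ, hcy]
  -- The ball around y lies in the ball of radius 2h around x, so the bound no longer involves the
  -- centre y, which may depend on x.
  have h4 : ∫⁻ z in Metric.ball y h, ‖f x - f z‖ₑ ^ 2 ≤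
      ∫⁻ a in Metric.ball (0 : Pt d) (2 * h), ‖f (x + a) - f x‖ₑ ^ 2 := by
    rw [← lintegral_indicator measurableSet_ball, ← lintegral_indicator measurableSet_ball,
      ← lintegral_add_left_eq_self _ x]
    refine lintegral_mono fun a => ?_
    by_cases ha : x + a ∈ Metric.ball y h
    · have ha' : a ∈ Metric.ball (0 : Pt d) (2 * h) := by
        rw [Metric.mem_ball] at ha ⊢
        have := dist_triangle_right (x + a) x y
        rw [dist_self_add_left] at this
        rw [dist_zero_right]
        linarith
      simp only [Set.indicator_of_mem ha, Set.indicator_of_mem ha']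
      rw [← enorm_neg, neg_sub]
    · simp [Set.indicator_of_notMem ha]
  calc _ ≤ c⁻¹ ^ 2 * (c * ∫⁻ z in Metric.ball y h, ‖f x - f z‖ₑ ^ 2) := by gcongr
    _ = c⁻¹ * ∫⁻ z in Metric.ball y h, ‖f x - f z‖ₑ ^ 2 := by
      rw [sq, mul_assoc, ← mul_assoc c⁻¹ c, ENNReal.inv_mul_cancel hc0 hct, one_mul]
    _ ≤ _ := by gcongr

/-- After exchanging the integrals, every translation has |a| < 2h; the factor 2^d is the ratio of
the volumes of the two balls. -/
theorem lintegral_ball_translate_le {f : Pt d → ℂ} (hf : ContDiff ℝ ∞ f) {h : ℝ} (hh : 0 < h) :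
    (volume (Metric.ball (0 : Pt d) h))⁻¹ *
      ∫⁻ x, ∫⁻ a in Metric.ball (0 : Pt d) (2 * h), ‖f (x + a) - f x‖ₑ ^ 2 ≤
    ENNReal.ofReal (2 ^ d * (2 * h) ^ 2) * ∫⁻ x, ‖classicalGrad f x‖ₑ ^ 2 := by
  have hc0 : volume (Metric.ball (0 : Pt d) h) ≠ 0 := (Metric.measure_ball_pos _ _ hh).ne'
  have hct : volume (Metric.ball (0 : Pt d) h) ≠ ⊤ := measure_ball_lt_top.ne
  have hfc := hf.continuous
  rw [lintegral_lintegral_swap (by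
    refine Continuous.aemeasurable ?_
    unfold Function.uncurry
    fun_prop)]
  have h1 : ∫⁻ a in Metric.ball (0 : Pt d) (2 * h), ∫⁻ x, ‖f (x + a) - f x‖ₑ ^ 2 ≤
      ∫⁻ a in Metric.ball (0 : Pt d) (2 * h),
        ENNReal.ofReal ((2 * h) ^ 2) * ∫⁻ x, ‖classicalGrad f x‖ₑ ^ 2 := by
    refine setLIntegral_mono' measurableSet_ball fun a ha => ?_
    refine (lintegral_translate_sub_le hf a).trans ?_
    gcongr
    rw [mem_ball_zero_iff] at ha
    rw [← ofReal_norm, ← ENNReal.ofReal_pow (norm_nonneg _)]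
    gcongr
  have h2 : volume (Metric.ball (0 : Pt d) (2 * h)) =
      ENNReal.ofReal (2 ^ d) * volume (Metric.ball (0 : Pt d) h) := by
    rw [Measure.addHaar_ball_mul_of_pos _ _ two_pos, finrank_euclideanSpace_fin]
  rw [setLIntegral_const, h2] at h1
  refine (mul_le_mul_right h1 _).trans (le_of_eq ?_)
  rw [ENNReal.ofReal_mul (by positivity)]
  calc _ = (volume (Metric.ball (0 : Pt d) h))⁻¹ * volume (Metric.ball (0 : Pt d) h) *
        (ENNReal.ofReal (2 ^ d) * ENNReal.ofReal ((2 * h) ^ 2) *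
          ∫⁻ x, ‖classicalGrad f x‖ₑ ^ 2) := by ring
    _ = _ := by rw [ENNReal.inv_mul_cancel hc0 hct, one_mul]

/-- A bounded set is covered by finitely many balls around the points of a dense sequence. -/
theorem exists_forall_dist_nearestPt_lt (hDb : Bornology.IsBounded D) {h : ℝ} (hh : 0 < h) :
    ∃ N, ∀ x ∈ D, dist x (SimpleFunc.nearestPt (TopologicalSpace.denseSeq (Pt d)) N x) < h := by
  set e := TopologicalSpace.denseSeq (Pt d)
  obtain ⟨t, ht⟩ := hDb.isCompact_closure.elim_finite_subcover
    (fun n => Metric.ball (e n) h) (fun n => Metric.isOpen_ball) (fun x _ => by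
      obtain ⟨n, hn⟩ := (TopologicalSpace.denseRange_denseSeq (Pt d)).exists_dist_lt x hh
      exact Set.mem_iUnion.2 ⟨n, hn⟩)
  refine ⟨t.sup id, fun x hx => ?_⟩
  obtain ⟨k, hk, hxk⟩ := Set.mem_iUnion₂.1 (ht (subset_closure hx))
  have h1 := SimpleFunc.edist_nearestPt_le e x (Finset.le_sup (f := id) hk)
  rw [edist_dist, edist_dist, ENNReal.ofReal_le_ofReal_iff dist_nonneg] at h1
  rw [dist_comm]
  refine h1.trans_lt ?_
  rw [dist_comm]
  exact hxk

/-- Approximation of the identity of `L²` by operators of finite rank, uniformly on `H¹₀`. -/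
theorem exists_compact_approx (hD : MeasurableSet D) (hDb : Bornology.IsBounded D) {ε : ℝ}
    (hε : 0 < ε) : ∃ A : L2 D →L[ℂ] L2 D, IsCompactOperator A ∧
      ∀ p ∈ testPairs D, ‖p.fst - A p.fst‖ ≤ ε * ‖p.snd‖ := by
  obtain ⟨h, hh, hhε⟩ : ∃ h : ℝ, 0 < h ∧ 2 ^ d * (2 * h) ^ 2 ≤ ε ^ 2 := by
    refine ⟨ε / (2 * 2 ^ d), by positivity, ?_⟩
    have h1 : (1 : ℝ) ≤ 2 ^ d := one_le_pow₀ one_le_two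
    have : 2 ^ d * (2 * (ε / (2 * 2 ^ d))) ^ 2 = ε ^ 2 / 2 ^ d := by field_simp
    rw [this]
    exact div_le_self (by positivity) h1
  obtain ⟨N, hN⟩ := exists_forall_dist_nearestPt_lt hDb hh
  set e := TopologicalSpace.denseSeq (Pt d)
  -- Here κ is the index of the nearest net point; its level sets partition space into finitely many
  -- cells.
  set κ := SimpleFunc.nearestPtInd e N
  set μ := volume.restrict D with hμ
  have : IsFiniteMeasure μ := ⟨by rw [Measure.restrict_apply_univ]; exact hDb.measure_lt_top⟩
  let ind : ∀ s : Set (Pt d), MeasurableSet s → L2 D := fun s hs =>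
    indicatorConstLp 2 hs (measure_ne_top μ s) (1 : ℂ)
  set c := (volume (Metric.ball (0 : Pt d) h)).toReal⁻¹ with hc
  -- Rank one: the average over the ball around the k-th net point, placed on the k-th cell.
  let T : ℕ → L2 D →L[ℂ] L2 D := fun k =>
    ((c : ℂ) • innerSL ℂ (ind (Metric.ball (e k) h) measurableSet_ball)).smulRight
      (ind (κ ⁻¹' {k}) (κ.measurableSet_preimage _))
  refine ⟨∑ k ∈ Finset.range (N + 1), T k, ?_, ?_⟩
  · refine (compactOperator (RingHom.id ℂ) (L2 D) (L2 D)).sum_mem fun k _ => ?_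
    have : IsCompactOperator (ContinuousLinearMap.toSpanSingleton ℂ
        (ind (κ ⁻¹' {k}) (κ.measurableSet_preimage _))) :=
      isCompactOperator_of_locallyCompactSpace_rng _
    exact this.comp_clm ((c : ℂ) • innerSL ℂ (ind (Metric.ball (e k) h) measurableSet_ball))
  · rintro p ⟨f, hf1, hf2, hf3, hf4, hf5⟩
    have hf : IsTest D f := ⟨hf1, hf2, hf3⟩
    have hae : ⇑(p.fst - (∑ k ∈ Finset.range (N + 1), T k) p.fst) =ᵐ[μ]
        fun x => f x - c • ∫ z in Metric.ball (SimpleFunc.nearestPt e N x) h, f z := by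
      have hT : (∑ k ∈ Finset.range (N + 1), T k) p.fst = ∑ k ∈ Finset.range (N + 1),
          ((c : ℂ) * ∫ z in Metric.ball (e k) h, f z) •
            ind (κ ⁻¹' {k}) (κ.measurableSet_preimage _) := by
        rw [sum_apply]
        refine Finset.sum_congr rfl fun k _ => ?_
        simp only [T, ContinuousLinearMap.smulRight_apply, smul_apply, innerSL_apply_apply,
          smul_eq_mul]
        congr 2
        rw [L2.inner_indicatorConstLp_one]
        rw [setIntegral_congr_ae measurableSet_ball (hf4.mono fun x hx _ => hx)]
        rw [Measure.restrict_restrict measurableSet_ball]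
        -- A test function vanishes off D, so integrating over the ball or over its part in D is the
        -- same.
        refine (setIntegral_eq_of_subset_of_forall_sdiff_eq_zero measurableSet_ball
          Set.inter_subset_left fun x hx => ?_).symm
        by_contra h0
        exact hx.2 ⟨hx.1, hf.support_subset h0⟩
      rw [hT]
      have h1 : ∀ᵐ x ∂μ, ∀ k, (ind (κ ⁻¹' {k}) (κ.measurableSet_preimage _) : Pt d → ℂ) x =
          (κ ⁻¹' {k}).indicator (fun _ => (1 : ℂ)) x :=
        ae_all_iff.2 fun k => indicatorConstLp_coeFn
      have h2 : ∀ᵐ x ∂μ, ∀ k, ((((c : ℂ) * ∫ z in Metric.ball (e k) h, f z) •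
          ind (κ ⁻¹' {k}) (κ.measurableSet_preimage _) : L2 D) : Pt d → ℂ) x =
          ((c : ℂ) * ∫ z in Metric.ball (e k) h, f z) *
            (ind (κ ⁻¹' {k}) (κ.measurableSet_preimage _) : Pt d → ℂ) x :=
        ae_all_iff.2 fun k => (Lp.coeFn_smul _ _)
      filter_upwards [Lp.coeFn_sub p.fst (∑ k ∈ Finset.range (N + 1),
          ((c : ℂ) * ∫ z in Metric.ball (e k) h, f z) •
            ind (κ ⁻¹' {k}) (κ.measurableSet_preimage _)),
        Lp.coeFn_fun_finsetSum (Finset.range (N + 1))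
          (fun k => ((c : ℂ) * ∫ z in Metric.ball (e k) h, f z) •
            ind (κ ⁻¹' {k}) (κ.measurableSet_preimage _)),
        hf4, h1, h2] with x g1 g2 g3 g4 g5
      rw [g1, Pi.sub_apply, g2, g3]
      congr 1
      simp only [g5, g4]
      rw [Finset.sum_eq_single (κ x)
        (fun k _ hk => by rw [Set.indicator_of_notMem fun h0 => hk h0.symm, mul_zero])
        (fun h0 => (h0 (Finset.mem_range.2
          (Nat.lt_succ_of_le (SimpleFunc.nearestPtInd_le e N x)))).elim),
        Set.indicator_of_mem (by exact rfl), mul_one]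
      rw [Complex.real_smul]
      rfl
    have h1 : eLpNorm (p.fst - (∑ k ∈ Finset.range (N + 1), T k) p.fst : L2 D) 2 μ ^ 2 ≤
        ENNReal.ofReal (ε ^ 2) * eLpNorm p.snd 2 μ ^ 2 := by
      rw [eLpNorm_congr_ae hae, eLpNorm_congr_ae hf5, eLpNorm_two_sq,
        eLpNorm_restrict_eq_of_support_subset hf.support_classicalGrad_subset, eLpNorm_two_sq]
      calc _ ≤ ∫⁻ x in D, (volume (Metric.ball (0 : Pt d) h))⁻¹ *
            ∫⁻ a in Metric.ball (0 : Pt d) (2 * h), ‖f (x + a) - f x‖ₑ ^ 2 :=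
          setLIntegral_mono' hD fun x hx =>
            enorm_sub_average_sq_le hf1.continuous hh (hN x hx)
        _ ≤ ∫⁻ x, (volume (Metric.ball (0 : Pt d) h))⁻¹ *
            ∫⁻ a in Metric.ball (0 : Pt d) (2 * h), ‖f (x + a) - f x‖ₑ ^ 2 :=
          setLIntegral_le_lintegral _ _
        _ = (volume (Metric.ball (0 : Pt d) h))⁻¹ *
            ∫⁻ x, ∫⁻ a in Metric.ball (0 : Pt d) (2 * h), ‖f (x + a) - f x‖ₑ ^ 2 :=
          lintegral_const_mul' _ _ (ENNReal.inv_ne_top.2 (Metric.measure_ball_pos _ _ hh).ne')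
        _ ≤ _ := (lintegral_ball_translate_le hf1 hh).trans (by gcongr)
    rw [← Lp.enorm_def, ← Lp.enorm_def, ENNReal.ofReal_pow hε.le, ← mul_pow] at h1
    have h2 := (ENNReal.pow_le_pow_left_iff two_ne_zero).1 h1
    rw [← ofReal_norm, ← ofReal_norm, ← ENNReal.ofReal_mul hε.le,
      ENNReal.ofReal_le_ofReal_iff (by positivity)] at h2
    exact h2

/-- The Rellich-Kondrachov theorem for `H¹₀`. -/
theorem isCompactOperator_fnL (hD : MeasurableSet D) (hDb : Bornology.IsBounded D) :
    IsCompactOperator (fnL D) := by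
  have key : ∀ n : ℕ, ∃ B : H10 D →L[ℝ] L2 D, IsCompactOperator B ∧
      ‖B - fnL D‖ ≤ 1 / ((n : ℝ) + 1) := by
    intro n
    have hε : 0 < 1 / ((n : ℝ) + 1) := by positivity
    obtain ⟨A, hA, hAp⟩ := exists_compact_approx hD hDb hε
    refine ⟨(A.restrictScalars ℝ).comp (fnL D), hA.comp_clm (fnL D), ?_⟩
    refine ContinuousLinearMap.opNorm_le_bound _ hε.le fun v => ?_
    obtain ⟨p, hp, hpv⟩ := exists_seq_testPairs v
    have t1 : Tendsto (fun n => (p n).fst) atTop (𝓝 (fn v)) :=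
      ((WithLp.continuous_fst 2 (L2 D) (L2Vec D)).tendsto _).comp hpv
    have t2 : Tendsto (fun n => ‖(p n).snd‖) atTop (𝓝 ‖grad v‖) :=
      (((WithLp.continuous_snd 2 (L2 D) (L2Vec D)).tendsto _).comp hpv).norm
    have t3 : Tendsto (fun n => ‖(p n).fst - A (p n).fst‖) atTop (𝓝 ‖fn v - A (fn v)‖) :=
      (t1.sub ((A.continuous.tendsto _).comp t1)).norm
    have h1 := le_of_tendsto_of_tendsto' t3 (t2.const_mul _) fun n => hAp _ (hp n)
    have h2 : ‖grad v‖ ≤ ‖v‖ := by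
      have := norm_sq_eq v
      exact (pow_le_pow_iff_left₀ (norm_nonneg _) (norm_nonneg _) two_ne_zero).1
        (by rw [this]; exact le_add_of_nonneg_left (by positivity))
    calc _ = ‖fn v - A (fn v)‖ := by rw [norm_sub_rev]; rfl
      _ ≤ _ := h1.trans (by gcongr)
  choose B hB1 hB2 using key
  -- Compact operators are closed under limits in operator norm.
  refine isCompactOperator_of_tendsto (F := B) (l := atTop) ?_ (Eventually.of_forall hB1)
  refine (tendsto_iff_norm_sub_tendsto_zero (E := H10 D →L[ℝ] L2 D)).2 ?_
  exact squeeze_zero (fun _ => ContinuousLinearMap.opNorm_nonneg _) hB2 tendsto_one_div_add_atTop_nhds_zero_nat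

end GPE
end

/-! ### The Gross-Pitaevskii forms as continuous operators on H¹₀. -/

noncomputable section

namespace GPE

variable {d : ℕ} {D : Set (Pt d)}

theorem inner_L2_eq_re (f g : L2 D) : inner ℝ f g = (inner ℂ f g).re := by
  rw [L2.inner_def, L2.inner_def]
  exact integral_re (L2.integrable_inner (𝕜 := ℂ) f g)

theorem inner_L2Vec_eq_re (f g : L2Vec D) : inner ℝ f g = (inner ℂ f g).re := by
  rw [L2.inner_def, L2.inner_def]
  refine Eq.trans ?_ (integral_re (L2.integrable_inner (𝕜 := ℂ) f g))
  refine integral_congr_ae (Eventually.of_forall fun x => ?_)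
  simp only [PiLp.inner_apply, map_sum]
  rfl

theorem inner_L2_smul_left (c : ℂ) (f g : L2 D) :
    inner ℝ (c • f) g = inner ℝ f (conj c • g) := by
  rw [inner_L2_eq_re, inner_L2_eq_re, inner_smul_left, inner_smul_right]

theorem inner_L2Vec_smul_left (c : ℂ) (f g : L2Vec D) :
    inner ℝ (c • f) g = inner ℝ f (conj c • g) := by
  rw [inner_L2Vec_eq_re, inner_L2Vec_eq_re, inner_smul_left, inner_smul_right]

/-- The vector field of `∇_R - ∇`. -/
def rotVec (Ω : ℝ) (x : Pt d) : EuclideanSpace ℂ (Fin d) :=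
  WithLp.toLp 2 fun k => Complex.I * ((Ω / 2 * rotField x k : ℝ) : ℂ)

theorem continuous_coord (k : ℕ) : Continuous fun x : Pt d => coord x k := by
  unfold coord
  split_ifs <;> fun_prop

theorem continuous_rotField (k : Fin d) : Continuous fun x : Pt d => rotField x k := by
  have h0 := continuous_coord (d := d) 0
  have h1 := continuous_coord (d := d) 1
  unfold rotField
  split_ifs <;> fun_prop

theorem Continuous.memLp_top_restrict {F : Type*} [NormedAddCommGroup F] {g : Pt d → F}
    [SecondCountableTopology F] (hg : Continuous g) (hD : MeasurableSet D)
    (hDb : Bornology.IsBounded D) : MemLp g ⊤ (volume.restrict D) := by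
  obtain ⟨C, hC⟩ := hDb.isCompact_closure.exists_bound_of_continuousOn hg.continuousOn
  exact memLp_top_of_bound hg.aestronglyMeasurable C
    ((ae_restrict_mem hD).mono fun x hx => hC x (subset_closure hx))

theorem memLp_rotVec (hD : MeasurableSet D) (hDb : Bornology.IsBounded D) (Ω : ℝ) :
    MemLp (rotVec (d := d) Ω) ⊤ (volume.restrict D) := by
  have h := continuous_rotField (d := d)
  refine Continuous.memLp_top_restrict ?_ hD hDb
  unfold rotVec
  fun_prop

theorem memLp_rotPot (hD : MeasurableSet D) (hDb : Bornology.IsBounded D) (Ω : ℝ)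
    {W : Pt d → ℝ} (hW : MemLp W ⊤ (volume.restrict D)) :
    MemLp (fun x => (rotPot Ω W x : ℂ)) ⊤ (volume.restrict D) := by
  have h := continuous_rotField (d := d)
  have h1 : MemLp (fun x : Pt d => Ω ^ 2 / 4 * ∑ k, rotField x k ^ 2) ⊤ (volume.restrict D) :=
    Continuous.memLp_top_restrict (by fun_prop) hD hDb
  exact (hW.sub h1).ofReal

/-- Multiplication of functions in `L²` by a fixed function in `L^∞`. -/
def mulTop {F : Type*} [NormedAddCommGroup F] [NormedSpace ℂ F]
    (g : Lp F ⊤ (volume.restrict D)) : L2 D →L[ℂ] Lp F 2 (volume.restrict D) :=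
  (ContinuousLinearMap.holderL (volume.restrict D) 2 ⊤ 2 (ContinuousLinearMap.lsmul ℂ ℂ)).flip g

theorem coeFn_mulTop {F : Type*} [NormedAddCommGroup F] [NormedSpace ℂ F]
    (g : Lp F ⊤ (volume.restrict D)) (f : L2 D) :
    mulTop g f =ᵐ[volume.restrict D] fun x => f x • g x :=
  ContinuousLinearMap.coeFn_holder (ContinuousLinearMap.lsmul ℂ ℂ) f g

/-- `∇_R` as a continuous operator. -/
def rotGradL (hD : MeasurableSet D) (hDb : Bornology.IsBounded D) (Ω : ℝ) :
    H10 D →L[ℂ] L2Vec D :=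
  (WithLp.sndL 2 ℂ (L2 D) (L2Vec D)).comp (H10 D).subtypeL +
    (mulTop (memLp_rotVec hD hDb Ω).toLp).comp
      ((WithLp.fstL 2 ℂ (L2 D) (L2Vec D)).comp (H10 D).subtypeL)

theorem coeFn_rotGradL (hD : MeasurableSet D) (hDb : Bornology.IsBounded D) (Ω : ℝ) (v : H10 D) :
    rotGradL hD hDb Ω v =ᵐ[volume.restrict D] fun x => WithLp.toLp 2 (rotGrad Ω v x) := by
  filter_upwards [Lp.coeFn_add (grad v) (mulTop (memLp_rotVec hD hDb Ω).toLp (fn v)),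
    coeFn_mulTop (memLp_rotVec hD hDb Ω).toLp (fn v), (memLp_rotVec hD hDb Ω).coeFn_toLp]
    with x h1 h2 h3
  refine Eq.trans h1 ?_
  rw [Pi.add_apply, h2, h3]
  ext k
  simp [rotGrad, rotVec]
  ring

/-- Multiplication by the potential `W_R`. -/
def rotPotL (hD : MeasurableSet D) (hDb : Bornology.IsBounded D) (Ω : ℝ)
    {W : Pt d → ℝ} (hW : MemLp W ⊤ (volume.restrict D)) : H10 D →L[ℂ] L2 D :=
  (mulTop (memLp_rotPot hD hDb Ω hW).toLp).comp
    ((WithLp.fstL 2 ℂ (L2 D) (L2Vec D)).comp (H10 D).subtypeL)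

theorem coeFn_rotPotL (hD : MeasurableSet D) (hDb : Bornology.IsBounded D) (Ω : ℝ)
    {W : Pt d → ℝ} (hW : MemLp W ⊤ (volume.restrict D)) (v : H10 D) :
    rotPotL hD hDb Ω hW v =ᵐ[volume.restrict D] fun x => (rotPot Ω W x : ℂ) * fn v x := by
  filter_upwards [coeFn_mulTop (memLp_rotPot hD hDb Ω hW).toLp (fn v),
    (memLp_rotPot hD hDb Ω hW).coeFn_toLp] with x h2 h3
  refine Eq.trans h2 ?_
  rw [h3, smul_eq_mul, mul_comm]

theorem linForm_eq (hD : MeasurableSet D) (hDb : Bornology.IsBounded D) (Ω : ℝ)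
    {W : Pt d → ℝ} (hW : MemLp W ⊤ (volume.restrict D)) (v w : H10 D) :
    linForm Ω W v w = inner ℂ (rotGradL hD hDb Ω w) (rotGradL hD hDb Ω v) +
      inner ℂ (fn w) (rotPotL hD hDb Ω hW v) := by
  rw [L2.inner_def, L2.inner_def, ← integral_add (L2.integrable_inner _ _)
    (L2.integrable_inner _ _), linForm]
  refine integral_congr_ae ?_
  filter_upwards [coeFn_rotGradL hD hDb Ω v, coeFn_rotGradL hD hDb Ω w,
    coeFn_rotPotL hD hDb Ω hW v] with x h1 h2 h3
  rw [h1, h2, h3]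
  simp only [PiLp.inner_apply, RCLike.inner_apply]

/-- The linear part of the form as a continuous bilinear form. -/
def linFormL (hD : MeasurableSet D) (hDb : Bornology.IsBounded D) (Ω : ℝ)
    {W : Pt d → ℝ} (hW : MemLp W ⊤ (volume.restrict D)) : H10 D →L[ℝ] H10 D →L[ℝ] ℝ :=
  (FormData.ip (L2Vec D)).bilinearComp ((rotGradL hD hDb Ω).restrictScalars ℝ)
      ((rotGradL hD hDb Ω).restrictScalars ℝ) +
    (FormData.ip (L2 D)).bilinearComp ((rotPotL hD hDb Ω hW).restrictScalars ℝ) (fnL D)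

theorem linFormL_apply (hD : MeasurableSet D) (hDb : Bornology.IsBounded D) (Ω : ℝ)
    {W : Pt d → ℝ} (hW : MemLp W ⊤ (volume.restrict D)) (v w : H10 D) :
    linFormL hD hDb Ω hW v w = inner ℝ (rotGradL hD hDb Ω v) (rotGradL hD hDb Ω w) +
      inner ℝ (rotPotL hD hDb Ω hW v) (fn w) := rfl

theorem re_linForm (hD : MeasurableSet D) (hDb : Bornology.IsBounded D) (Ω : ℝ)
    {W : Pt d → ℝ} (hW : MemLp W ⊤ (volume.restrict D)) (v w : H10 D) :
    (linForm Ω W v w).re = linFormL hD hDb Ω hW v w := by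
  rw [linForm_eq hD hDb Ω hW, linFormL_apply, real_inner_comm, real_inner_comm (fn w),
    inner_L2Vec_eq_re, inner_L2_eq_re, Complex.add_re]

theorem inner_rotPotL_comm (hD : MeasurableSet D) (hDb : Bornology.IsBounded D) (Ω : ℝ)
    {W : Pt d → ℝ} (hW : MemLp W ⊤ (volume.restrict D)) (v w : H10 D) :
    inner ℝ (rotPotL hD hDb Ω hW v) (fn w) = inner ℝ (rotPotL hD hDb Ω hW w) (fn v) := by
  rw [L2.inner_def, L2.inner_def]
  refine integral_congr_ae ?_
  filter_upwards [coeFn_rotPotL hD hDb Ω hW v, coeFn_rotPotL hD hDb Ω hW w] with x h1 h2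
  rw [h1, h2]
  simp [Complex.inner]
  ring

theorem linFormL_symm (hD : MeasurableSet D) (hDb : Bornology.IsBounded D) (Ω : ℝ)
    {W : Pt d → ℝ} (hW : MemLp W ⊤ (volume.restrict D)) (v w : H10 D) :
    linFormL hD hDb Ω hW v w = linFormL hD hDb Ω hW w v := by
  rw [linFormL_apply, linFormL_apply, real_inner_comm, inner_rotPotL_comm]

theorem linFormL_smul (hD : MeasurableSet D) (hDb : Bornology.IsBounded D) (Ω : ℝ)
    {W : Pt d → ℝ} (hW : MemLp W ⊤ (volume.restrict D)) (c : ℂ) (v w : H10 D) :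
    linFormL hD hDb Ω hW (c • v) w = linFormL hD hDb Ω hW v (conj c • w) := by
  rw [linFormL_apply, linFormL_apply, map_smul, map_smul, map_smul, fn_smul,
    inner_L2Vec_smul_left, inner_L2_smul_left]

instance : ENNReal.HolderTriple 4 4 2 where
  inv_add_inv_eq_inv := by
    rw [← two_mul, show (4 : ENNReal) = 2 * 2 by norm_num,
      ENNReal.mul_inv (by simp) (by simp), ← mul_assoc,
      ENNReal.mul_inv_cancel (by simp) (by simp), one_mul]

instance : Fact ((1 : ENNReal) ≤ 4) := ⟨by norm_num⟩

theorem memLp_fn_four (hd : d = 2 ∨ d = 3) (hD : MeasurableSet D)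
    (hDb : Bornology.IsBounded D) (v : H10 D) : MemLp (fn v) 4 (volume.restrict D) := by
  obtain ⟨C, hC⟩ := exists_eLpNorm_fn_four_le hd hD hDb
  exact ⟨Lp.aestronglyMeasurable _, (hC v).trans_lt
    (ENNReal.mul_lt_top ENNReal.coe_lt_top enorm_lt_top)⟩

theorem norm_grad_le (v : H10 D) : ‖grad v‖ ≤ ‖v‖ :=
  (pow_le_pow_iff_left₀ (norm_nonneg _) (norm_nonneg _) two_ne_zero).1
    (by rw [norm_sq_eq v]; exact le_add_of_nonneg_left (by positivity))

/-- The Sobolev embedding of `H¹₀` into `L⁴`. -/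
def fnFour (hd : d = 2 ∨ d = 3) (hD : MeasurableSet D) (hDb : Bornology.IsBounded D) :
    H10 D →L[ℝ] Lp ℂ 4 (volume.restrict D) :=
  LinearMap.mkContinuousOfExistsBound
    { toFun := fun v => (memLp_fn_four hd hD hDb v).toLp
      map_add' := fun v w => by
        rw [← MemLp.toLp_add]
        exact MemLp.toLp_congr _ _ (Lp.coeFn_add (fn v) (fn w))
      map_smul' := fun c v => by
        rw [RingHom.id_apply, ← MemLp.toLp_const_smul]
        exact MemLp.toLp_congr _ _ (Lp.coeFn_smul c (fn v)) }
    (by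
      obtain ⟨C, hC⟩ := exists_eLpNorm_fn_four_le hd hD hDb
      refine ⟨C, fun v => ?_⟩
      refine le_trans ?_ (mul_le_mul_of_nonneg_left (norm_grad_le v) C.2)
      refine (Lp.norm_toLp _ (memLp_fn_four hd hD hDb v)).trans_le ?_
      refine ENNReal.toReal_le_of_le_ofReal (by positivity) ((hC v).trans (le_of_eq ?_))
      rw [ENNReal.ofReal_mul C.coe_nonneg, ofReal_norm, ENNReal.ofReal_coe_nnreal])

theorem coeFn_fnFour (hd : d = 2 ∨ d = 3) (hD : MeasurableSet D) (hDb : Bornology.IsBounded D)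
    (v : H10 D) : fnFour hd hD hDb v =ᵐ[volume.restrict D] fn v :=
  MemLp.coeFn_toLp (memLp_fn_four hd hD hDb v)

/-- The product `(v, w) ↦ v w` of functions in `H¹₀`, with values in `L²`. -/
def mulL (hd : d = 2 ∨ d = 3) (hD : MeasurableSet D) (hDb : Bornology.IsBounded D) :
    H10 D →L[ℝ] H10 D →L[ℝ] L2 D :=
  (ContinuousLinearMap.holderL (volume.restrict D) 4 4 2 (ContinuousLinearMap.mul ℝ ℂ)).bilinearComp
    (fnFour hd hD hDb) (fnFour hd hD hDb)

theorem coeFn_mulL (hd : d = 2 ∨ d = 3) (hD : MeasurableSet D) (hDb : Bornology.IsBounded D)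
    (v w : H10 D) : mulL hd hD hDb v w =ᵐ[volume.restrict D] fun x => fn v x * fn w x := by
  filter_upwards [ContinuousLinearMap.coeFn_holder (r := 2) (ContinuousLinearMap.mul ℝ ℂ)
    (fnFour hd hD hDb v) (fnFour hd hD hDb w), coeFn_fnFour hd hD hDb v,
    coeFn_fnFour hd hD hDb w] with x h1 h2 h3
  refine Eq.trans h1 ?_
  rw [h2, h3]
  rfl

theorem mulL_symm (hd : d = 2 ∨ d = 3) (hD : MeasurableSet D) (hDb : Bornology.IsBounded D)
    (v w : H10 D) : mulL hd hD hDb v w = mulL hd hD hDb w v := by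
  refine Lp.ext ?_
  filter_upwards [coeFn_mulL hd hD hDb v w, coeFn_mulL hd hD hDb w v] with x h1 h2
  rw [h1, h2, mul_comm]

theorem mulL_smul (hd : d = 2 ∨ d = 3) (hD : MeasurableSet D) (hDb : Bornology.IsBounded D)
    (c : ℂ) (v w : H10 D) : mulL hd hD hDb (c • v) w = c • mulL hd hD hDb v w := by
  refine Lp.ext ?_
  filter_upwards [coeFn_mulL hd hD hDb v w, coeFn_mulL hd hD hDb (c • v) w,
    Lp.coeFn_smul c (mulL hd hD hDb v w), Lp.coeFn_smul c (fn v)] with x h1 h2 h3 h4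
  rw [h2, h3, Pi.smul_apply, h1, fn_smul, h4, Pi.smul_apply, smul_eq_mul, smul_eq_mul, mul_assoc]

theorem integral_mul_fderiv_test {f ψ : Pt d → ℂ} (hf : IsTest D f) (hψ : IsTest D ψ) (a : Pt d) :
    ∫ x, ψ x * fderiv ℝ f x a = -∫ x, fderiv ℝ ψ x a * f x := by
  have cf := hf.1.continuous
  have cψ := hψ.1.continuous
  have cf' : Continuous (fderiv ℝ f) := hf.1.continuous_fderiv (by simp)
  have cψ' : Continuous (fderiv ℝ ψ) := hψ.1.continuous_fderiv (by simp)
  refine integral_mul_fderiv_eq_neg_fderiv_mul_of_integrable ?_ ?_ ?_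
    (fun x _ => hψ.1.differentiable (by simp) x) (fun x _ => hf.1.differentiable (by simp) x)
  · exact Continuous.integrable_of_hasCompactSupport (by fun_prop) hf.2.1.mul_left
  · exact Continuous.integrable_of_hasCompactSupport (by fun_prop) hψ.2.1.mul_right
  · exact Continuous.integrable_of_hasCompactSupport (by fun_prop) hψ.2.1.mul_right

/-- The defining identity of weak derivatives. -/
theorem integral_mul_grad (v : H10 D) {ψ : Pt d → ℂ} (hψ : IsTest D ψ) (k : Fin d) :
    ∫ x in D, ψ x * grad v x k =
      -∫ x in D, fderiv ℝ ψ x (EuclideanSpace.single k 1) * fn v x := by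
  have cψ' : Continuous (fderiv ℝ ψ) := hψ.1.continuous_fderiv (by simp)
  set a : Pt d := EuclideanSpace.single k 1
  have m1 : MemLp (fun x => conj (ψ x)) 2 (volume.restrict D) :=
    ((hψ.1.continuous.memLp_of_hasCompactSupport hψ.2.1).restrict D).star
  have m2 : MemLp (fun x => conj (fderiv ℝ ψ x a)) 2 (volume.restrict D) :=
    (((by fun_prop : Continuous fun x => fderiv ℝ ψ x a).memLp_of_hasCompactSupport
      (hψ.2.1.fderiv_apply ℝ a)).restrict D).star
  have m3 : MemLp (fun x => EuclideanSpace.single k (conj (ψ x))) 2 (volume.restrict D) :=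
    m1.of_le (by
      exact ((PiLp.continuous_toLp 2 _).comp ((continuous_single k).comp
        (Complex.continuous_conj.comp hψ.1.continuous))).aestronglyMeasurable) (Eventually.of_forall fun x => by simp)
  have h1 : ∀ p : WithLp 2 (L2 D × L2Vec D), inner ℂ m3.toLp p.snd =
      ∫ x in D, ψ x * p.snd x k := fun p => by
    rw [L2.inner_def]
    refine integral_congr_ae ?_
    filter_upwards [m3.coeFn_toLp] with x hx
    rw [hx, EuclideanSpace.inner_single_left]
    simp
  have h2 : ∀ p : WithLp 2 (L2 D × L2Vec D), inner ℂ m2.toLp p.fst =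
      ∫ x in D, fderiv ℝ ψ x a * p.fst x := fun p => by
    rw [L2.inner_def]
    refine integral_congr_ae ?_
    filter_upwards [m2.coeFn_toLp] with x hx
    rw [hx, RCLike.inner_apply]
    simp [mul_comm]
  have h3 : ∀ p ∈ testPairs D, inner ℂ m3.toLp p.snd = -inner ℂ m2.toLp p.fst := by
    rintro p ⟨f, hf1, hf2, hf3, hf4, hf5⟩
    have hf : IsTest D f := ⟨hf1, hf2, hf3⟩
    rw [h1, h2]
    have e1 : ∫ x in D, ψ x * p.snd x k = ∫ x, ψ x * fderiv ℝ f x a := by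
      refine Eq.trans ?_ (setIntegral_eq_integral_of_forall_compl_eq_zero (s := D) fun x hx => ?_)
      · exact integral_congr_ae (hf5.mono fun x hx => by simp only [hx, classicalGrad, a])
      · rw [Function.notMem_support.1 fun h => hx (hψ.support_subset h), zero_mul]
    have e2 : ∫ x in D, fderiv ℝ ψ x a * p.fst x = ∫ x, fderiv ℝ ψ x a * f x := by
      refine Eq.trans ?_ (setIntegral_eq_integral_of_forall_compl_eq_zero (s := D) fun x hx => ?_)
      · exact integral_congr_ae (hf4.mono fun x hx => by simp only [hx])
      · rw [Function.notMem_support.1 fun h => hx (hf.support_subset h), mul_zero]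
    rw [e1, e2, integral_mul_fderiv_test hf hψ]
  obtain ⟨p, hp, hpv⟩ := exists_seq_testPairs v
  have t1 : Tendsto (fun n => inner ℂ m2.toLp (p n).fst) atTop (𝓝 (inner ℂ m2.toLp (fn v))) :=
    tendsto_const_nhds.inner (((WithLp.continuous_fst 2 (L2 D) (L2Vec D)).tendsto _).comp hpv)
  have t2 : Tendsto (fun n => inner ℂ m3.toLp (p n).snd) atTop (𝓝 (inner ℂ m3.toLp (grad v))) :=
    tendsto_const_nhds.inner (((WithLp.continuous_snd 2 (L2 D) (L2Vec D)).tendsto _).comp hpv)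
  have h4 := tendsto_nhds_unique t2 (t1.neg.congr fun n => (h3 _ (hp n)).symm)
  exact (h1 _).symm.trans (h4.trans (congrArg _ (h2 _)))

/-- Elements of H¹₀ are pairs, so it must be shown that the function determines the gradient: by the
weak derivative identity the gradient integrates to zero against all test functions on the open set
D. This makes the embedding into L² injective. -/
theorem grad_eq_zero (hDo : IsOpen D) {v : H10 D} (hv : fn v = 0) : grad v = 0 := by
  have h1 : ∀ k, ∀ᵐ x, x ∈ D → grad v x k = 0 := by
    intro k
    have hm : MemLp (fun x => grad v x k) 2 (volume.restrict D) :=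
      (Lp.memLp (grad v)).of_le (by
        have := Lp.aestronglyMeasurable (grad v)
        exact (EuclideanSpace.proj (𝕜 := ℂ) k).continuous.comp_aestronglyMeasurable this)
        (Eventually.of_forall fun x => PiLp.norm_apply_le _ _)
    refine hDo.ae_eq_zero_of_integral_contDiff_smul_eq_zero
      (locallyIntegrableOn_of_locallyIntegrable_restrict
        (hm.locallyIntegrable (by norm_num))) fun g hg1 hg2 hg3 => ?_
    have hψ : IsTest D fun x => (g x : ℂ) := by
      refine ⟨Complex.ofRealCLM.contDiff.comp hg1, hg2.comp_left Complex.ofReal_zero, ?_⟩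
      exact (tsupport_comp_subset (g := Complex.ofReal) Complex.ofReal_zero g).trans hg3
    have := integral_mul_grad v hψ k
    rw [← setIntegral_eq_integral_of_forall_compl_eq_zero (s := D) fun x hx => by
        rw [Function.notMem_support.1 fun h => hx (hg3 (subset_tsupport g h)), zero_smul]]
    simp only [Complex.real_smul]
    rw [this, neg_eq_zero]
    refine integral_eq_zero_of_ae ?_
    rw [hv]
    filter_upwards [Lp.coeFn_zero ℂ 2 (volume.restrict D)] with x hx
    rw [hx]; simp
  refine Lp.ext ?_
  have h2 := (ae_restrict_iff' hDo.measurableSet).2 ((ae_all_iff.2 h1).mono fun x hx h k => hx k h)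
  filter_upwards [h2, Lp.coeFn_zero (EuclideanSpace ℂ (Fin d)) 2 (volume.restrict D)] with x h3 h4
  rw [h4]
  ext k
  exact h3 k

theorem fnL_injective (hDo : IsOpen D) : Function.Injective (fnL D) := by
  rw [injective_iff_map_eq_zero]
  intro v hv
  have h1 : fn v = 0 := hv
  have h2 := norm_sq_eq v
  rw [h1, grad_eq_zero hDo h1, norm_zero, norm_zero] at h2
  exact norm_eq_zero.1 (by nlinarith)

/-- The functional-analytic data of the Gross-Pitaevskii problem on `D`. -/
def gpData (hd : d = 2 ∨ d = 3) (hDo : IsOpen D) (hDb : Bornology.IsBounded D) (Ω κ : ℝ)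
    {W : Pt d → ℝ} (hW : MemLp W ⊤ (volume.restrict D)) : FormData (H10 D) (L2 D) (L2 D) where
  j := fnL D
  a := linFormL hDo.measurableSet hDb Ω hW
  M := mulL hd hDo.measurableSet hDb
  κ := κ
  j_injective := fnL_injective hDo
  j_compact := isCompactOperator_fnL hDo.measurableSet hDb
  a_symm := linFormL_symm _ _ _ _
  M_symm := mulL_symm _ _ _
  j_smul c v w := inner_L2_smul_left c (fn v) (fn w)
  a_smul := linFormL_smul _ _ _ _
  M_smul c v w x y := by rw [mulL_smul, mulL_smul, inner_L2_smul_left]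

end GPE
end

/-! ### Identification of the concrete problem with the abstract one. -/

noncomputable section

namespace GPE

variable {d : ℕ} {D : Set (Pt d)}

theorem inner_L2_eq_integral (f g : L2 D) : inner ℂ f g = ∫ x in D, g x * conj (f x) := by
  rw [L2.inner_def]
  simp only [RCLike.inner_apply]

theorem hInner_eq (v w : H10 D) : hInner v w = inner ℝ (fn v) (fn w) := by
  rw [real_inner_comm, inner_L2_eq_re, inner_L2_eq_integral, hInner]

theorem integral_cubic_eq (hd : d = 2 ∨ d = 3) (hD : MeasurableSet D)
    (hDb : Bornology.IsBounded D) (u v w : H10 D) :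
    ∫ x in D, ((‖fn u x‖ ^ 2 : ℝ) : ℂ) * fn v x * conj (fn w x) =
      inner ℂ (mulL hd hD hDb u w) (mulL hd hD hDb u v) := by
  rw [inner_L2_eq_integral]
  refine integral_congr_ae ?_
  filter_upwards [coeFn_mulL hd hD hDb u v, coeFn_mulL hd hD hDb u w] with x h1 h2
  rw [h1, h2, map_mul, Complex.ofReal_pow, ← Complex.mul_conj']
  ring

/-- Pointwise, u v̄ u w̄ is u² times the conjugate of vw, and |u|² v w̄ is uv times the conjugate of
uw; hence products without conjugation are enough to express J. -/
theorem integral_cubic_deriv_eq (hd : d = 2 ∨ d = 3) (hD : MeasurableSet D)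
    (hDb : Bornology.IsBounded D) (u v w : H10 D) :
    ∫ x in D, (fn u x * conj (fn v x) + 2 * fn v x * conj (fn u x)) * fn u x * conj (fn w x) =
      inner ℂ (mulL hd hD hDb v w) (mulL hd hD hDb u u) +
        2 * inner ℂ (mulL hd hD hDb u w) (mulL hd hD hDb u v) := by
  have h := fun f g : L2 D => L2.integrable_inner (𝕜 := ℂ) f g
  rw [L2.inner_def, L2.inner_def, ← integral_const_mul, ← integral_add (h _ _) ((h _ _).const_mul _)]
  refine integral_congr_ae ?_
  filter_upwards [coeFn_mulL hd hD hDb u v, coeFn_mulL hd hD hDb u w, coeFn_mulL hd hD hDb v w,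
    coeFn_mulL hd hD hDb u u] with x h1 h2 h3 h4
  simp only [RCLike.inner_apply, h1, h2, h3, h4, map_mul]
  ring

section Data

variable (hd : d = 2 ∨ d = 3) (hDo : IsOpen D) (hDb : Bornology.IsBounded D) (Ω κ : ℝ)
  {W : Pt d → ℝ} (hW : MemLp W ⊤ (volume.restrict D))

theorem gpData_j : (gpData hd hDo hDb Ω κ hW).j = fnL D := rfl

theorem gpData_a : (gpData hd hDo hDb Ω κ hW).a = linFormL hDo.measurableSet hDb Ω hW := rfl

theorem gpData_M : (gpData hd hDo hDb Ω κ hW).M = mulL hd hDo.measurableSet hDb := rfl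

theorem gpData_κ : (gpData hd hDo hDb Ω κ hW).κ = κ := rfl

theorem re_inner_L2 (f g : L2 D) : (inner ℂ f g).re = inner ℝ g f := by
  rw [real_inner_comm, inner_L2_eq_re]

theorem re_add_mul_sub_mul (l x y z : ℂ) (r s : ℝ) :
    (l + (r : ℂ) * (x + 2 * y) - (s : ℂ) * z).re = l.re + r * (x.re + 2 * y.re) - s * z.re := by
  simp

set_option maxHeartbeats 1000000 in
theorem gpJ_eq_inner (u v w : H10 D) : gpJ Ω κ W u v w = linFormL hDo.measurableSet hDb Ω hW v w +
    κ / hNorm u ^ 2 * (inner ℝ (mulL hd hDo.measurableSet hDb u u)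
        (mulL hd hDo.measurableSet hDb v w) +
      2 * inner ℝ (mulL hd hDo.measurableSet hDb u v) (mulL hd hDo.measurableSet hDb u w)) -
    2 * κ * hInner u v / hNorm u ^ 4 *
      inner ℝ (mulL hd hDo.measurableSet hDb u u) (mulL hd hDo.measurableSet hDb u w) := by
  have hD := hDo.measurableSet
  rw [gpJ, integral_cubic_eq hd hD hDb u u w, integral_cubic_deriv_eq hd hD hDb u v w,
    re_add_mul_sub_mul, re_linForm hD hDb Ω hW v w, re_inner_L2, re_inner_L2, re_inner_L2]

set_option maxHeartbeats 1000000 in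
theorem gpJ_eq (u v w : H10 D) : gpJ Ω κ W u v w = (gpData hd hDo hDb Ω κ hW).J u v w := by
  rw [gpJ_eq_inner hd hDo hDb Ω κ hW u v w, FormData.J_apply, hInner_eq]
  simp only [gpData_j, gpData_a, gpData_M, gpData_κ, fnL_apply, hNorm]
  ring

set_option maxHeartbeats 1000000 in
theorem gpA_eq (u v w : H10 D) : gpA Ω κ W u v w = (gpData hd hDo hDb Ω κ hW).a v w +
    κ / hNorm u ^ 2 * inner ℝ ((gpData hd hDo hDb Ω κ hW).M u v)
      ((gpData hd hDo hDb Ω κ hW).M u w) := by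
  have hD := hDo.measurableSet
  rw [gpA, integral_cubic_eq hd hD hDb u v w, Complex.add_re, Complex.re_ofReal_mul,
    re_linForm hD hDb Ω hW v w, re_inner_L2]
  rfl

theorem solvesShifted_iff (σ : ℝ) (u v : H10 D) (F : H10 D → ℝ) :
    SolvesShifted Ω κ W σ u v F ↔ ∀ w, (gpData hd hDo hDb Ω κ hW).Js σ u v w = F w := by
  simp only [SolvesShifted, FormData.Js_apply, gpJ_eq hd hDo hDb Ω κ hW, hInner_eq]
  rfl

theorem HasBoundedInverse.bijective {σ : ℝ} {u : H10 D} (h : HasBoundedInverse Ω κ W σ u) :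
    Function.Bijective ((gpData hd hDo hDb Ω κ hW).Js σ u) := by
  simp only [HasBoundedInverse, solvesShifted_iff hd hDo hDb Ω κ hW] at h
  constructor
  · intro v w hvw
    exact (h.1 _).unique (fun _ => rfl) fun x => by rw [hvw]
  · intro F
    obtain ⟨v, hv, -⟩ := h.1 F
    exact ⟨v, ContinuousLinearMap.ext hv⟩

/-- The bound on the inverse is automatic by the open mapping theorem. -/
theorem hasBoundedInverse_of_bijective {σ : ℝ} {u : H10 D}
    (h : Function.Bijective ((gpData hd hDo hDb Ω κ hW).Js σ u)) :
    HasBoundedInverse Ω κ W σ u := by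
  simp only [HasBoundedInverse, solvesShifted_iff hd hDo hDb Ω κ hW]
  refine ⟨fun F => ?_, ?_⟩
  · obtain ⟨v, hv⟩ := h.2 F
    refine ⟨v, fun w => by rw [hv], fun v' hv' => h.1 ?_⟩
    rw [hv]
    exact ContinuousLinearMap.ext hv'
  · obtain ⟨C, hC⟩ := FormData.exists_norm_le_of_bijective _ h
    exact ⟨C, fun F v hv => (norm_grad_le v).trans (hC F v hv)⟩

/-- `IsStep` demands nothing where J_σ is not bijective, so the default value 0 of `psi` never
matters; elsewhere the chosen solution is the only one. -/
theorem isStep_phi (σ : ℝ) (u : H10 D) :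
    (gpData hd hDo hDb Ω κ hW).IsStep σ u (phi Ω κ W σ u) := by
  intro hb v hv
  have hs : SolvesShifted Ω κ W σ u v (hInner u) :=
    (solvesShifted_iff hd hDo hDb Ω κ hW σ u v _).2 fun w => (hv w).trans (hInner_eq u w).symm
  have hex : ∃ v, SolvesShifted Ω κ W σ u v (hInner u) := ⟨v, hs⟩
  have hpsi : psi Ω κ W σ u = v := by
    rw [psi, dif_pos hex]
    apply hb.1
    ext w
    rw [hv w, (solvesShifted_iff hd hDo hDb Ω κ hW σ u _ _).1 hex.choose_spec w, hInner_eq]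
    rfl
  rw [phi, hpsi]
  rfl

end Data

set_option maxHeartbeats 2000000 in
/-- Local linear convergence of the shifted `J`-method with any rate above the spectral one. -/
theorem exists_convergence_iter (hd : d = 2 ∨ d = 3) (hDo : IsOpen D)
    (hDb : Bornology.IsBounded D) {W : Pt d → ℝ} (hW : MemLp W ⊤ (volume.restrict D)) {Ω κ : ℝ}
    {us : H10 D} {lam : ℝ} (heig : IsNormalizedEigenpair Ω κ W us lam)
    (hsimple : IsSimpleUpToPhase Ω κ W us lam) {σ : ℝ} (hσ : σ ≠ -lam)
    (hinv : HasBoundedInverse Ω κ W σ us) {μ : ℝ} (hμ : IsEigenvalueJ Ω κ W us μ)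
    (hμmin : ∀ ν : ℝ, IsEigenvalueJ Ω κ W us ν → ν ≠ lam → |μ + σ| ≤ |ν + σ|)
    {θ : ℝ} (hθ : |lam + σ| / |μ + σ| < θ) (hθ1 : θ < 1) :
    ∃ δ C : ℝ, 0 < δ ∧ 0 < C ∧ ∀ u₀ : H10 D, vNorm (u₀ - us) < δ →
      (∀ n : ℕ, HasBoundedInverse Ω κ W σ (iter Ω κ W σ u₀ n)) ∧
      ∃ c : ℂ, ‖c‖ = 1 ∧ ∀ n : ℕ,
        vNorm ((Real.sign (lam + σ)) ^ n • iter Ω κ W σ u₀ n - c • us) ≤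
          C * θ ^ n * vNorm (u₀ - us) := by
  obtain ⟨P, hj, hJ, hA, hbij, hbij', hstep⟩ : ∃ P : FormData (H10 D) (L2 D) (L2 D),
      P.j = fnL D ∧ (∀ v w, gpJ Ω κ W us v w = P.J us v w) ∧
      (∀ w, gpA Ω κ W us us w = P.a us w +
        P.κ / hNorm us ^ 2 * inner ℝ (P.M us us) (P.M us w)) ∧
      Function.Bijective (P.Js σ us) ∧
      (∀ u, Function.Bijective (P.Js σ u) → HasBoundedInverse Ω κ W σ u) ∧
      ∀ u, P.IsStep σ u (phi Ω κ W σ u) :=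
    ⟨gpData hd hDo hDb Ω κ hW, rfl, gpJ_eq hd hDo hDb Ω κ hW us,
      gpA_eq hd hDo hDb Ω κ hW us us, hinv.bijective hd hDo hDb Ω κ hW,
      fun _ => hasBoundedInverse_of_bijective hd hDo hDb Ω κ hW, isStep_phi hd hDo hDb Ω κ hW σ⟩
  have hH : ∀ v w : H10 D, hInner v w = inner ℝ (P.j v) (P.j w) := by rw [hj]; exact hInner_eq
  have hu : ‖P.j us‖ = 1 := by rw [hj]; exact heig.1
  have he : ∀ w, P.a us w + P.κ * inner ℝ (P.M us us) (P.M us w) =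
      lam * inner ℝ (P.j us) (P.j w) := fun w => by
    have := heig.2 w
    rwa [hA, heig.1, one_pow, div_one, hH] at this
  -- If μ + σ = 0, an eigenfunction for μ would lie in the kernel of the invertible J_σ.
  have hm : 0 < |μ + σ| := by
    rw [abs_pos]
    intro h0
    obtain ⟨v, hv0, hv⟩ := hμ
    apply hv0
    apply hbij.1
    ext w
    rw [P.Js_apply, ← hJ, hv, hH, ← add_mul, h0, zero_mul, map_zero]
    rfl
  have hgen : ∀ w z : H10 D, (∀ x, P.J us w x - lam * inner ℝ (P.j w) (P.j x) =
      inner ℝ (P.j z) (P.j x)) → (∀ x, P.J us z x = lam * inner ℝ (P.j z) (P.j x)) →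
      ∃ c : ℂ, w = c • us := by
    intro w z hw hz
    -- Jordan chains of length two are all that the spectral bound uses.
    refine hsimple.2 2 w ⟨z, ⟨0, rfl, fun x => ?_⟩, fun x => ?_⟩
    · rw [hJ, hz, hH, hH, map_zero, inner_zero_left, sub_self]
    · rw [hJ, hH, hH, hw]
  have hmin : ∀ (ν : ℝ) (v : H10 D), v ≠ 0 →
      (∀ x, P.J us v x = ν * inner ℝ (P.j v) (P.j x)) → ν ≠ lam → |μ + σ| ≤ |ν + σ| :=
    fun ν v hv0 hv => hμmin ν ⟨v, hv0, fun w => by rw [hJ, hH, hv]⟩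
  obtain ⟨δ, C, hδ, hC, hmain⟩ := P.exists_convergence hu he
    (P.equivJs_apply hbij)
    (fun h => hσ (by linarith)) hm hgen hmin hθ hθ1
  obtain ⟨K, hK⟩ := exists_norm_fn_le hd hDo.measurableSet hDb
  -- By Poincaré the H¹ norm of the abstract result and the gradient norm are equivalent; the factor
  -- K + 1 is absorbed in δ and C.
  have hK' : ∀ v : H10 D, ‖v‖ ≤ (K + 1) * vNorm v := fun v => by
    have h1 := norm_sq_eq v
    have h2 := hK v
    have h3 : (0 : ℝ) ≤ ‖grad v‖ := norm_nonneg _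
    refine (pow_le_pow_iff_left₀ (norm_nonneg _) (by unfold vNorm; positivity) two_ne_zero).1 ?_
    have h4 : ‖fn v‖ ^ 2 ≤ (K * ‖grad v‖) ^ 2 := by gcongr
    unfold vNorm
    nlinarith [mul_nonneg K.coe_nonneg (sq_nonneg ‖grad v‖)]
  have hK1 : (0 : ℝ) < K + 1 := by positivity
  have hθ0 : 0 < θ := lt_of_le_of_lt (by positivity) hθ
  refine ⟨δ / (K + 1), C * (K + 1), by positivity, by positivity, fun u₀ hu₀ => ?_⟩
  rw [lt_div_iff₀ hK1, mul_comm] at hu₀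
  obtain ⟨h1, c, hc, h2⟩ := hmain (iter Ω κ W σ u₀) ((hK' _).trans_lt hu₀)
    fun n => hstep _
  refine ⟨fun n => hbij' _ (h1 n), c, hc, fun n => ?_⟩
  calc _ ≤ _ := norm_grad_le _
    _ ≤ C * θ ^ n * ‖u₀ - us‖ := h2 n
    _ ≤ C * θ ^ n * ((K + 1) * vNorm (u₀ - us)) := by gcongr; exact hK' _
    _ = _ := by ring

end GPE
end

/-! ### Both assertions from linear convergence at an arbitrary rate θ in (ρ, 1). -/

theorem mainTheorem2 (d : ℕ) (hd : d = 2 ∨ d = 3) (D : Set (GPE.Pt d))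
    (hDo : IsOpen D) (hDb : Bornology.IsBounded D)
    (W : GPE.Pt d → ℝ) (hW : MemLp W ⊤ (volume.restrict D))
    (Ω κ : ℝ) (hκ : 0 ≤ κ)
    (us : GPE.H10 D) (lam : ℝ) (heig : GPE.IsNormalizedEigenpair Ω κ W us lam)
    (hsimple : GPE.IsSimpleUpToPhase Ω κ W us lam)
    (σ : ℝ) (hσ : σ ≠ -lam) (hinv : GPE.HasBoundedInverse Ω κ W σ us)
    (μ : ℝ) (hμ : GPE.IsEigenvalueJ Ω κ W us μ) (hμne : μ ≠ lam)
    (hμmin : ∀ ν : ℝ, GPE.IsEigenvalueJ Ω κ W us ν → ν ≠ lam → |μ + σ| ≤ |ν + σ|)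
    (hgap : |lam + σ| / |μ + σ| < 1) :
    (∃ δ : ℝ, 0 < δ ∧ ∀ u₀ : GPE.H10 D, GPE.vNorm (u₀ - us) < δ →
      (∀ n : ℕ, GPE.HasBoundedInverse Ω κ W σ (GPE.iter Ω κ W σ u₀ n)) ∧
      ∃ c : ℂ, ‖c‖ = 1 ∧
        Tendsto (fun n : ℕ => GPE.vNorm
          ((Real.sign (lam + σ)) ^ n • GPE.iter Ω κ W σ u₀ n - c • us)) atTop (𝓝 0)) ∧
    (∀ ε : ℝ, 0 < ε → ∃ δ C : ℝ, 0 < δ ∧ 0 < C ∧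
      ∀ u₀ : GPE.H10 D, GPE.vNorm (u₀ - us) < δ →
        (∀ n : ℕ, GPE.HasBoundedInverse Ω κ W σ (GPE.iter Ω κ W σ u₀ n)) ∧
        ∃ c : ℂ, ‖c‖ = 1 ∧ ∀ n : ℕ,
          GPE.vNorm ((Real.sign (lam + σ)) ^ n • GPE.iter Ω κ W σ u₀ n - c • us) ≤
            C * (|lam + σ| / |μ + σ| + ε) ^ n * GPE.vNorm (u₀ - us)) := by
  set ρ := |lam + σ| / |μ + σ| with hρ
  have hρ0 : 0 ≤ ρ := by positivity
  have key : ∀ θ : ℝ, ρ < θ → θ < 1 → _ := fun θ hθ hθ1 =>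
    GPE.exists_convergence_iter hd hDo hDb hW heig hsimple hσ hinv hμ hμmin hθ hθ1
  constructor
  · obtain ⟨δ, C, hδ, hC, h⟩ := key ((ρ + 1) / 2) (by linarith) (by linarith)
    refine ⟨δ, hδ, fun u₀ hu₀ => ?_⟩
    obtain ⟨h1, c, hc, h2⟩ := h u₀ hu₀
    refine ⟨h1, c, hc, squeeze_zero (fun _ => norm_nonneg _) h2 ?_⟩
    have := tendsto_pow_atTop_nhds_zero_of_lt_one (by linarith : 0 ≤ (ρ + 1) / 2) (by linarith)
    simpa using (this.const_mul C).mul_const (GPE.vNorm (u₀ - us))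
  · intro ε hε
    -- The minimum keeps the rate below 1 when ε is large.
    obtain ⟨δ, C, hδ, hC, h⟩ := key (min (ρ + ε) ((ρ + 1) / 2))
      (lt_min (by linarith) (by linarith)) ((min_le_right _ _).trans_lt (by linarith))
    refine ⟨δ, C, hδ, hC, fun u₀ hu₀ => ?_⟩
    obtain ⟨h1, c, hc, h2⟩ := h u₀ hu₀
    refine ⟨h1, c, hc, fun n => (h2 n).trans ?_⟩
    have h3 : 0 ≤ min (ρ + ε) ((ρ + 1) / 2) := le_min (by linarith) (by linarith)
    have h4 : 0 ≤ GPE.vNorm (u₀ - us) := norm_nonneg _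
    gcongr
    exact min_le_left _ _
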